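/- **Setting.** Let $G$ be a Lie group with Lie algebra $\mathfrak g$, acting smoothly from the right on a manifold $M$ by $\vartheta_g\colon M\to M$ ($g\in G$), and let $x\mapsto v_x$, $v_x(m)=\frac{d}{dt}\big|_{0}\vartheta_{\exp(tx)}(m)$, be the corresponding infinitesimal action. For $p=x_1\wedge\dots\wedge x_k$ put $v_p=v_{x_1}\wedge\dots\wedge v_{x_k}$ and $\iota(v_p)=\iota_{v_{x_k}}\cdots\iota_{v_{x_1}}$, and extend linearly to $p\in\Lambda^k\mathfrak g$. Let $\varsigma(k)=-(-1)^{k(k+1)/2}$, let $$\partial(x_1\wedge\dots\wedge x_k)=\sum_{1\le i<j\le k}(-1)^{i+j}[x_i,x_j]\wedge x_1\wedge\dots\wedge\hat x_i\wedge\dots\wedge\hat x_j\wedge\dots\wedge x_k$$ be the Lie algebra homology differential, and $Z_k(\mathfrak g)=\ker(\partial|_{\Lambda^k\mathfrak g})$. A *pre-$n$-plectic manifold* $(M,\omega)$ is a manifold with a closed form $\omega\in\Omega^{n+1}(M)$. A *co-momentum map* for an infinitesimal action $v\colon\mathfrak h\to\mathfrak X(M)$ of a Lie algebra $\mathfrak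 h$ (a Lie algebra homomorphism) that is multisymplectic, i.e. satisfies $\mathcal L_{v_x}\omega=0$ for all $x\in\mathfrak h$, is a family of linear maps $f_i\colon\Lambda^i\mathfrak h\to\Omega^{n-i}(M)$, $1\le i\le n$, such that, with $f_0=f_{n+1}=0$, $$-f_{i-1}(\partial q)=d f_i(q)+\varsigma(i)\,\iota(v_q)\omega\qquad(q\in\Lambda^i\mathfrak h,\ 1\le i\le n+1);$$ in particular $d(f_1(x))=-\iota_{v_x}\omega$ for $x\in\mathfrak h$, so that $f_1(x)$ is a Hamiltonian form. The co-momentum map $(f)$ of the $G$-action is *$G$-equivariant* if $\vartheta_g^*f_i(q)=f_i(\mathrm{Ad}_g q)$ for all $g\in G$, $1\le i\le n$, $q\in\Lambda^i\mathfrak g$; equivariance for a subgroup and its Lie algebra is defined in the same way. **Proposition.** Let $G$ act on a pre-$n$-plectic manifold $(M,\omega)$ as above, let $(f)$ be a co-momentum map for the infinitesimal action of $\mathfrak g$ on $(M,\omega)$, let $1\le k\le n$, and fix $p\in Z_k(\mathfrak g)$. Let $G_p=\{g\in G:\mathrm{Ad}_g p=p\}$, let $G_p^0$ be the connected component of the identity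 in $G_p$, and let $\mathfrak g_p=\{x\in\mathfrak g:[x,p]=0\}$ be its Lie algebra. Then $(M,\iota(v_p)\omega)$ is a pre-$(n-k)$-plectic manifold, $\iota(v_p)\omega$ is invariant under $G_p^0$, and the maps $$f^p_j\colon\Lambda^j\mathfrak g_p\to\Omega^{n-k-j}(M),\qquad q\mapsto-\varsigma(k)\,f_{j+k}(q\wedge p)\qquad(j=1,\dots,n-k)$$ form a co-momentum map for the (restricted) action of $G_p^0$, i.e. of $\mathfrak g_p$, on $(M,\iota(v_p)\omega)$. If moreover $(f)$ is $G$-equivariant, then $(f^p)$ is $G_p^0$-equivariant. -/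

import Mathlib

set_option linter.unusedSectionVars false
open scoped Manifold ContDiff

namespace Multisymplectic
noncomputable section

section Algebra

variable {V : Type*} [AddCommGroup V] [Module ℝ V]

/-- The extension of a linear endomorphism `φ` of `V` to a derivation of the exterior algebra. -/
def extendDerivation (φ : V →ₗ[ℝ] V) : ExteriorAlgebra ℝ V →ₗ[ℝ] ExteriorAlgebra ℝ V :=
  CliffordAlgebra.foldr' (0 : QuadraticForm ℝ V)
    (LinearMap.mk₂ ℝ (fun (x : V) (q : ExteriorAlgebra ℝ V × ExteriorAlgebra ℝ V) =>
        ExteriorAlgebra.ι ℝ (φ x) * q.1 + ExteriorAlgebra.ι ℝ x * q.2)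
      (by intros; simp only [map_add, add_mul]; abel)
      (by intros; simp only [map_smul, smul_mul_assoc, smul_add])
      (by intros; simp only [Prod.fst_add, Prod.snd_add, mul_add]; abel)
      (by intros; simp only [Prod.smul_fst, Prod.smul_snd, mul_smul_comm, smul_add]))
    (by
      intro x q r
      change ExteriorAlgebra.ι ℝ (φ x) * (ExteriorAlgebra.ι ℝ x * q) + ExteriorAlgebra.ι ℝ x *
        (ExteriorAlgebra.ι ℝ (φ x) * q + ExteriorAlgebra.ι ℝ x * r) = (0 : ℝ) • r
      rw [mul_add, ← mul_assoc, ← mul_assoc, ← mul_assoc, ExteriorAlgebra.ι_sq_zero, zero_mul,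
        add_zero, ← add_mul, ExteriorAlgebra.ι_add_mul_swap, zero_mul, zero_smul]) 0

theorem extendDerivation_one (φ : V →ₗ[ℝ] V) : extendDerivation φ 1 = 0 := by
  rw [← map_one (algebraMap ℝ (ExteriorAlgebra ℝ V))]
  exact (CliffordAlgebra.foldr'_algebraMap (0 : QuadraticForm ℝ V) _ _ _ _).trans (smul_zero _)

theorem extendDerivation_ι_mul (φ : V →ₗ[ℝ] V) (x : V) (q : ExteriorAlgebra ℝ V) :
    extendDerivation φ (ExteriorAlgebra.ι ℝ x * q) =
      ExteriorAlgebra.ι ℝ (φ x) * q + ExteriorAlgebra.ι ℝ x * extendDerivation φ q :=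
  CliffordAlgebra.foldr'_ι_mul (0 : QuadraticForm ℝ V) _ _ _ _ _

theorem ι_mul_ι_mul (x y : V) (q : ExteriorAlgebra ℝ V) :
    ExteriorAlgebra.ι ℝ x * (ExteriorAlgebra.ι ℝ y * q) =
      -(ExteriorAlgebra.ι ℝ y * (ExteriorAlgebra.ι ℝ x * q)) := by
  rw [← mul_assoc, ← mul_assoc, ← neg_mul, eq_neg_of_add_eq_zero_left
    (ExteriorAlgebra.ι_add_mul_swap x y)]

theorem extendDerivation_ιMulti (φ : V →ₗ[ℝ] V) {k : ℕ} (x : Fin (k + 1) → V) :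
    extendDerivation φ (ExteriorAlgebra.ιMulti ℝ (k + 1) x) =
      ∑ j : Fin (k + 1), (-1 : ℝ) ^ (j : ℕ) •
        (ExteriorAlgebra.ι ℝ (φ (x j)) * ExteriorAlgebra.ιMulti ℝ k (j.removeNth x)) := by
  induction k with
  | zero =>
    rw [ExteriorAlgebra.ιMulti_succ_apply, extendDerivation_ι_mul]
    simp [extendDerivation_one]
  | succ k ih =>
    rw [ExteriorAlgebra.ιMulti_succ_apply, extendDerivation_ι_mul, ih, Finset.mul_sum]
    conv_rhs => rw [Fin.sum_univ_succ]
    congr 1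
    · simp [Fin.removeNth_zero, Matrix.vecTail, Fin.tail_def, Function.comp_def]
    · refine Finset.sum_congr rfl fun j _ => ?_
      rw [ExteriorAlgebra.ιMulti_succ_apply (v := j.succ.removeNth x), mul_smul_comm, ι_mul_ι_mul]
      simp [pow_succ, Fin.removeNth, Matrix.vecTail, Function.comp_def]
      rfl

variable {L : Type*} [LieRing L] [LieAlgebra ℝ L]

/-- The bracket `[x, ·]` on the exterior algebra: the extension of `ad x` to a derivation. -/
def adExt (x : L) : ExteriorAlgebra ℝ L →ₗ[ℝ] ExteriorAlgebra ℝ L :=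
  extendDerivation (LieAlgebra.ad ℝ L x : L →ₗ[ℝ] L)


theorem adExt_ι_mul (x y : L) (q : ExteriorAlgebra ℝ L) :
    adExt x (ExteriorAlgebra.ι ℝ y * q) =
      ExteriorAlgebra.ι ℝ ⁅x, y⁆ * q + ExteriorAlgebra.ι ℝ y * adExt x q :=
  extendDerivation_ι_mul _ _ _

theorem exterior_induction {P : ExteriorAlgebra ℝ V → Prop} (h1 : P 1)
    (hadd : ∀ a b, P a → P b → P (a + b)) (hsmul : ∀ (r : ℝ) a, P a → P (r • a))
    (hmul : ∀ (x : V) a, P a → P (ExteriorAlgebra.ι ℝ x * a)) (q : ExteriorAlgebra ℝ V) : P q := by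
  refine CliffordAlgebra.left_induction (0 : QuadraticForm ℝ V) (P := P) (fun r => ?_)
    (fun a b => hadd a b) (fun a x => hmul x a) q
  rw [Algebra.algebraMap_eq_smul_one]
  exact hsmul r 1 h1

theorem adExt_add (x y : L) (q : ExteriorAlgebra ℝ L) :
    adExt (x + y) q = adExt x q + adExt y q := by
  induction q using exterior_induction with
  | h1 => simp [adExt, extendDerivation_one]
  | hadd a b ha hb => rw [map_add, map_add, map_add, ha, hb]; abel
  | hsmul r a ha => rw [map_smul, map_smul, map_smul, ha, smul_add]
  | hmul z a ha => rw [adExt_ι_mul, adExt_ι_mul, adExt_ι_mul, ha, add_lie, map_add]; noncomm_ring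

theorem adExt_smul (r : ℝ) (x : L) (q : ExteriorAlgebra ℝ L) :
    adExt (r • x) q = r • adExt x q := by
  induction q using exterior_induction with
  | h1 => simp [adExt, extendDerivation_one]
  | hadd a b ha hb => rw [map_add, map_add, ha, hb, smul_add]
  | hsmul s a ha => rw [map_smul, map_smul, ha, smul_comm]
  | hmul z a ha =>
    rw [adExt_ι_mul, adExt_ι_mul, ha, smul_lie, map_smul, smul_mul_assoc, mul_smul_comm, smul_add]

theorem adExt_lie (x y : L) (q : ExteriorAlgebra ℝ L) :
    adExt ⁅x, y⁆ q = adExt x (adExt y q) - adExt y (adExt x q) := by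
  induction q using exterior_induction with
  | h1 => simp [adExt, extendDerivation_one]
  | hadd a b ha hb => simp only [map_add, ha, hb]; abel
  | hsmul s a ha => simp only [map_smul, ha, smul_sub]
  | hmul z a ha =>
    simp only [adExt_ι_mul, map_add, ha, lie_lie, map_sub]
    noncomm_ring

/-- The Lie algebra homology differential on the whole exterior algebra; its value on
`x₀ ∧ ⋯ ∧ xₖ₊₁` is given by `boundary_ιMulti`. -/
def boundary : ExteriorAlgebra ℝ L →ₗ[ℝ] ExteriorAlgebra ℝ L :=
  CliffordAlgebra.foldr' (0 : QuadraticForm ℝ L)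
    (LinearMap.mk₂ ℝ (fun (x : L) (q : ExteriorAlgebra ℝ L × ExteriorAlgebra ℝ L) =>
        -(ExteriorAlgebra.ι ℝ x * q.2) - adExt x q.1)
      (by intros; simp only [map_add, add_mul, adExt_add]; abel)
      (by intros; simp only [map_smul, smul_mul_assoc, smul_sub, smul_neg, adExt_smul])
      (by intros; simp only [Prod.fst_add, Prod.snd_add, mul_add, map_add]; abel)
      (by intros; simp only [Prod.smul_fst, Prod.smul_snd, mul_smul_comm, map_smul, smul_sub,
        smul_neg]))
    (by
      intro x q r
      change -(ExteriorAlgebra.ι ℝ x * (-(ExteriorAlgebra.ι ℝ x * r) - adExt x q)) -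
        adExt x (ExteriorAlgebra.ι ℝ x * q) = (0 : ℝ) • r
      rw [adExt_ι_mul, lie_self, map_zero, zero_mul, zero_add, mul_sub, mul_neg, ← mul_assoc,
        ExteriorAlgebra.ι_sq_zero, zero_mul, zero_smul]
      abel) 0

theorem boundary_one : boundary (1 : ExteriorAlgebra ℝ L) = 0 := by
  rw [← map_one (algebraMap ℝ (ExteriorAlgebra ℝ L))]
  exact (CliffordAlgebra.foldr'_algebraMap (0 : QuadraticForm ℝ L) _ _ _ _).trans (smul_zero _)

theorem boundary_ι_mul (x : L) (q : ExteriorAlgebra ℝ L) :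
    boundary (ExteriorAlgebra.ι ℝ x * q) =
      -(ExteriorAlgebra.ι ℝ x * boundary q) - adExt x q :=
  CliffordAlgebra.foldr'_ι_mul (0 : QuadraticForm ℝ L) _ _ _ _ _

theorem boundary_ιMulti {k : ℕ} (x : Fin (k + 2) → L) :
    boundary (ExteriorAlgebra.ιMulti ℝ (k + 2) x) =
      ∑ j : Fin (k + 2), ∑ i : Fin (k + 1), if i.castSucc < j then
        (-1 : ℝ) ^ ((i : ℕ) + (j : ℕ)) • (ExteriorAlgebra.ι ℝ ⁅x i.castSucc, x j⁆ *
          ExteriorAlgebra.ιMulti ℝ k (i.removeNth (j.removeNth x))) else 0 := by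
  induction k with
  | zero =>
    rw [ExteriorAlgebra.ιMulti_succ_apply, boundary_ι_mul, ExteriorAlgebra.ιMulti_succ_apply,
      boundary_ι_mul, adExt_ι_mul]
    simp [boundary_one, adExt, extendDerivation_one, Fin.sum_univ_succ, Matrix.vecTail]
  | succ k ih =>
    rw [ExteriorAlgebra.ιMulti_succ_apply, boundary_ι_mul, ih, adExt, extendDerivation_ιMulti]
    conv_rhs => rw [Fin.sum_univ_succ]
    simp only [Fin.not_lt_zero, if_false, Finset.sum_const_zero, zero_add]
    rw [sub_eq_add_neg, add_comm, Finset.mul_sum, ← Finset.sum_neg_distrib,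
      ← Finset.sum_neg_distrib, ← Finset.sum_add_distrib]
    refine Finset.sum_congr rfl fun j _ => ?_
    rw [Fin.sum_univ_succ (n := k + 1)]
    congr 1
    · simp [pow_succ, Fin.removeNth_zero, Fin.tail_def, Fin.removeNth, Matrix.vecTail,
        Function.comp_def]
    · rw [Finset.mul_sum, ← Finset.sum_neg_distrib]
      refine Finset.sum_congr rfl fun i _ => ?_
      by_cases h : i.castSucc < j
      · rw [if_pos h, if_pos (by simpa using h),
          ExteriorAlgebra.ιMulti_succ_apply (v := i.succ.removeNth (j.succ.removeNth x)),
          mul_smul_comm, ι_mul_ι_mul]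
        simp [Fin.removeNth, Matrix.vecTail, Function.comp_def]
        rw [show (i : ℕ) + 1 + ((j : ℕ) + 1) = (i + j) + 2 by ring, pow_add _ _ 2, neg_one_sq,
          mul_one]
        rfl
      · rw [if_neg h, if_neg (by simpa using h)]; simp

theorem boundary_mem {k : ℕ} {p : ExteriorAlgebra ℝ L} (hp : p ∈ ⋀[ℝ]^(k + 1) L) :
    boundary p ∈ ⋀[ℝ]^k L := by
  rw [← ExteriorAlgebra.ιMulti_span_fixedDegree] at hp
  induction hp using Submodule.span_induction with
  | zero => rw [map_zero]; exact Submodule.zero_mem _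
  | add a b _ _ ha hb => rw [map_add]; exact Submodule.add_mem _ ha hb
  | smul r a _ ha => rw [map_smul]; exact Submodule.smul_mem _ _ ha
  | mem a ha =>
    obtain ⟨x, rfl⟩ := ha
    cases k with
    | zero =>
      rw [ExteriorAlgebra.ιMulti_succ_apply, boundary_ι_mul]
      simp [boundary_one, adExt, extendDerivation_one]
    | succ k =>
      rw [boundary_ιMulti]
      refine Submodule.sum_mem _ fun j _ => Submodule.sum_mem _ fun i _ => ?_
      split_ifs
      · refine Submodule.smul_mem _ _ ?_
        have h := ExteriorAlgebra.ιMulti_range ℝ (k + 1) (M := L)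
          ⟨Matrix.vecCons ⁅x i.castSucc, x j⁆ (i.removeNth (j.removeNth x)), rfl⟩
        rw [ExteriorAlgebra.ιMulti_succ_apply] at h
        exact h
      · exact Submodule.zero_mem _

/-- The Lie algebra homology differential `∂ : Λᵏ⁺¹ L → Λᵏ L`. -/
def boundaryAt (k : ℕ) : ⋀[ℝ]^(k + 1) L →ₗ[ℝ] ⋀[ℝ]^k L :=
  (boundary.domRestrict (⋀[ℝ]^(k + 1) L)).codRestrict (⋀[ℝ]^k L) fun p => boundary_mem p.2

/-- The map `q ↦ q ∧ p`, from `Λʲ V` to `Λʲ⁺ᵏ V`. -/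
def wedgeRight (j : ℕ) {k : ℕ} (p : ⋀[ℝ]^k V) : ⋀[ℝ]^j V →ₗ[ℝ] ⋀[ℝ]^(j + k) V :=
  ((LinearMap.mulRight ℝ (p : ExteriorAlgebra ℝ V)).domRestrict (⋀[ℝ]^j V)).codRestrict
    (⋀[ℝ]^(j + k) V) fun q => SetLike.mul_mem_graded q.2 p.2

/-- The sign `ς(k) = -(-1)^{k(k+1)/2}`. -/
def varsigma (k : ℕ) : ℝ := -(-1) ^ (k * (k + 1) / 2)

/-- The isotropy Lie algebra `{x | [x, p] = 0}` of `p ∈ Λᵏ L`. -/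
def isotropyAlgebra {k : ℕ} (p : ⋀[ℝ]^k L) : LieSubalgebra ℝ L where
  carrier := {x | adExt x (p : ExteriorAlgebra ℝ L) = 0}
  zero_mem' := by
    change adExt 0 _ = 0
    have h := adExt_smul (0 : ℝ) (0 : L) (p : ExteriorAlgebra ℝ L)
    rwa [zero_smul, zero_smul] at h
  add_mem' {x y} hx hy := by
    change adExt x _ = 0 at hx
    change adExt y _ = 0 at hy
    change adExt (x + y) _ = 0
    rw [adExt_add, hx, hy, add_zero]
  smul_mem' r x hx := by
    change adExt x _ = 0 at hx
    change adExt (r • x) _ = 0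
    rw [adExt_smul, hx, smul_zero]
  lie_mem' {x y} hx hy := by
    change adExt x _ = 0 at hx
    change adExt y _ = 0 at hy
    change adExt ⁅x, y⁆ _ = 0
    rw [adExt_lie, hx, hy, map_zero, map_zero, sub_zero]

theorem mem_isotropyAlgebra {k : ℕ} (p : ⋀[ℝ]^k L) (x : L) :
    x ∈ isotropyAlgebra p ↔ adExt x (p : ExteriorAlgebra ℝ L) = 0 := Iff.rfl

theorem adExt_map {L' : Type*} [LieRing L'] [LieAlgebra ℝ L'] (A : L →ₗ[ℝ] L')
    (hA : ∀ x y, A ⁅x, y⁆ = ⁅A x, A y⁆) (x : L) (q : ExteriorAlgebra ℝ L) :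
    adExt (A x) (ExteriorAlgebra.map A q) = ExteriorAlgebra.map A (adExt x q) := by
  induction q using exterior_induction with
  | h1 => simp [adExt, extendDerivation_one]
  | hadd a b ha hb => simp only [map_add, ha, hb]
  | hsmul s a ha => simp only [map_smul, ha]
  | hmul z a ha =>
    rw [map_mul, ExteriorAlgebra.map_apply_ι, adExt_ι_mul, ha, adExt_ι_mul, map_add, map_mul,
      map_mul, ExteriorAlgebra.map_apply_ι, ExteriorAlgebra.map_apply_ι, hA]

theorem coe_exteriorPower_map {W : Type*} [AddCommGroup W] [Module ℝ W] (k : ℕ) (A : V →ₗ[ℝ] W)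
    (q : ⋀[ℝ]^k V) : (exteriorPower.map k A q : ExteriorAlgebra ℝ W) =
      ExteriorAlgebra.map A (q : ExteriorAlgebra ℝ V) := by
  suffices h : (⋀[ℝ]^k W).subtype ∘ₗ exteriorPower.map k A =
      (ExteriorAlgebra.map A).toLinearMap ∘ₗ (⋀[ℝ]^k V).subtype from LinearMap.congr_fun h q
  refine exteriorPower.linearMap_ext ?_
  ext x
  simp [ExteriorAlgebra.map_apply_ιMulti]

theorem append_update_right {α : Type*} {k e : ℕ} [DecidableEq (Fin e)] 
    (x : Fin k → α) (w : Fin e → α) (i : Fin e) (a : α) :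
    Fin.append x (Function.update w i a) =
      Function.update (Fin.append x w) (Fin.natAdd k i) a := by
  ext j
  refine Fin.addCases (fun j => ?_) (fun j => ?_) j
  · rw [Fin.append_left, Function.update_of_ne, Fin.append_left]
    exact fun h => by have := congrArg Fin.val h; simp at this; omega
  · rw [Fin.append_right]
    by_cases h : j = i
    · subst h; simp
    · rw [Function.update_of_ne h, Function.update_of_ne, Fin.append_right]
      simpa using h

theorem append_update_left {α : Type*} {k e : ℕ} [DecidableEq (Fin k)] 
    (x : Fin k → α) (w : Fin e → α) (i : Fin k) (a : α) :
    Fin.append (Function.update x i a) w =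
      Function.update (Fin.append x w) (Fin.castAdd e i) a := by
  ext j
  refine Fin.addCases (fun j => ?_) (fun j => ?_) j
  · rw [Fin.append_left]
    by_cases h : j = i
    · subst h; simp
    · rw [Function.update_of_ne h, Function.update_of_ne, Fin.append_left]
      simpa using h
  · rw [Fin.append_right, Function.update_of_ne, Fin.append_right]
    exact fun h => by have := congrArg Fin.val h; simp at this; omega

section Contraction

variable [TopologicalSpace V] {N k e : ℕ}

/-- The form `η(x₁, …, xₖ, ·, …, ·)`. -/
def contractTuple (h : k + e = N) (η : V [⋀^Fin N]→L[ℝ] ℝ) (x : Fin k → V) :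
    V [⋀^Fin e]→L[ℝ] ℝ where
  toFun w := η (Fin.append x w ∘ Fin.cast h.symm)
  map_update_add' w i a b := by
    subst h
    simp only [append_update_right, Fin.cast_refl, Function.comp_id]
    exact η.map_update_add _ _ _ _
  map_update_smul' w i c a := by
    subst h
    simp only [append_update_right, Fin.cast_refl, Function.comp_id]
    exact η.map_update_smul _ _ _ _
  map_eq_zero_of_eq' w i j hw hij := by
    subst h
    refine η.map_eq_zero_of_eq _ (i := Fin.natAdd k i) (j := Fin.natAdd k j) ?_ (by simpa using hij)
    simpa using hw
  cont := by
    subst h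
    refine η.cont.comp (continuous_pi fun j => ?_)
    refine Fin.addCases (fun j => ?_) (fun j => ?_) j
    · simpa using continuous_const
    · simpa using continuous_apply j

/-- The contraction `ι(P) η` of a form `η` on `V` with `P ∈ Λᵏ V`. It is linear in `P`, and
`ι(x₁ ∧ ⋯ ∧ xₖ) η = ι(xₖ) ⋯ ι(x₁) η = η(x₁, …, xₖ, ·, …, ·)`. -/
def contractMulti (h : k + e = N) (η : V [⋀^Fin N]→L[ℝ] ℝ) :
    ⋀[ℝ]^k V →ₗ[ℝ] V [⋀^Fin e]→L[ℝ] ℝ :=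
  exteriorPower.alternatingMapLinearEquiv
    { toFun := contractTuple h η
      map_update_add' := by
        intro _ x i a b
        subst h
        ext w
        simp only [contractTuple, append_update_left, Fin.cast_refl, Function.comp_id]
        exact η.map_update_add _ _ _ _
      map_update_smul' := by
        intro _ x i c a
        subst h
        ext w
        simp only [contractTuple, append_update_left, Fin.cast_refl, Function.comp_id]
        exact η.map_update_smul _ _ _ _
      map_eq_zero_of_eq' := by
        intro x i j hx hij
        subst h
        ext w
        refine η.map_eq_zero_of_eq _ (i := Fin.castAdd e i) (j := Fin.castAdd e j) ?_
          (by simpa using hij)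
        simpa using hx }

theorem contractMulti_ιMulti (h : k + e = N) (η : V [⋀^Fin N]→L[ℝ] ℝ) (x : Fin k → V)
    (w : Fin e → V) :
    contractMulti h η (exteriorPower.ιMulti ℝ k x) w = η (Fin.append x w ∘ Fin.cast h.symm) := by
  rw [contractMulti, exteriorPower.alternatingMapLinearEquiv_apply_ιMulti]
  rfl

end Contraction

end Algebra

section Forms

variable (E : Type*) [NormedAddCommGroup E] [NormedSpace ℝ E]
  (M : Type*) [TopologicalSpace M] [ChartedSpace E M] [IsManifold 𝓘(ℝ, E) ∞ M]

/-- Not necessarily smooth differential forms of degree `d` on `M`. -/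
abbrev Form (d : ℕ) : Type _ := ∀ m : M, TangentSpace 𝓘(ℝ, E) m [⋀^Fin d]→L[ℝ] ℝ

/-- Not necessarily smooth vector fields on `M`. -/
abbrev VField : Type _ := ∀ m : M, TangentSpace 𝓘(ℝ, E) m

variable {E M}

/-- The pullback `φ^* α` of a form. -/
def pullback {d : ℕ} (φ : M → M) (α : Form E M d) : Form E M d :=
  fun m => (α (φ m)).compContinuousLinearMap (mfderiv 𝓘(ℝ, E) 𝓘(ℝ, E) φ m)

/-- The expression of a form in the chart at `m₀`, i.e. its pullback under the inverse of
this chart. It is meaningful on the target of the chart. -/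
def inChart {d : ℕ} (α : Form E M d) (m₀ : M) : E → E [⋀^Fin d]→L[ℝ] ℝ :=
  fun y => (α ((extChartAt 𝓘(ℝ, E) m₀).symm y)).compContinuousLinearMap
    (mfderiv 𝓘(ℝ, E) 𝓘(ℝ, E) (extChartAt 𝓘(ℝ, E) m₀).symm y)

/-- A form is smooth if its expressions in the charts are. -/
def IsSmoothForm {d : ℕ} (α : Form E M d) : Prop :=
  ∀ m₀ : M, ContDiffOn ℝ ∞ (inChart α m₀) (extChartAt 𝓘(ℝ, E) m₀).target

variable (E M) in
/-- The space `Ω^d(M)` of smooth differential forms. -/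
def smoothForms (d : ℕ) : Submodule ℝ (Form E M d) where
  carrier := {α | IsSmoothForm α}
  zero_mem' := fun _ => contDiffOn_const (c := 0)
  add_mem' ha hb := fun m₀ => (ha m₀).add (hb m₀)
  smul_mem' c _ ha := fun m₀ => (ha m₀).const_smul c

/-- The exterior derivative: at `m`, it is computed in the chart at `m`. -/
def extD {d : ℕ} (α : Form E M d) : Form E M (d + 1) :=
  fun m => (extDeriv (inChart α m) (extChartAt 𝓘(ℝ, E) m m)).compContinuousLinearMap
    (mfderiv 𝓘(ℝ, E) 𝓘(ℝ, E) (extChartAt 𝓘(ℝ, E) m) m)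

/-- The contraction of a form with a multivector field. -/
def contract {N k e : ℕ} (h : k + e = N) (P : ∀ m : M, ⋀[ℝ]^k (TangentSpace 𝓘(ℝ, E) m))
    (α : Form E M N) : Form E M e :=
  fun m => contractMulti h (α m) (P m)

/-- The contraction `ι_X α` of a form with a vector field. -/
def interior {N e : ℕ} (h : 1 + e = N) (X : VField E M) (α : Form E M N) : Form E M e :=
  contract h (fun m => exteriorPower.ιMulti ℝ 1 fun _ => X m) α

/-- The Lie derivative `L_X α = d ι_X α + ι_X d α`. -/
def lieDerivative {e : ℕ} (X : VField E M) (α : Form E M (e + 1)) : Form E M (e + 1) :=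
  extD (interior (Nat.add_comm 1 e) X α) + interior (Nat.add_comm 1 (e + 1)) X (extD α)

/-- Smoothness of a vector field, as a section of the tangent bundle. -/
def IsSmoothVField (X : VField E M) : Prop :=
  ContMDiff 𝓘(ℝ, E) (𝓘(ℝ, E).prod 𝓘(ℝ, E)) ∞ (fun m => (⟨m, X m⟩ : TangentBundle 𝓘(ℝ, E) M))

/-- `(M, η)` is a pre-`n`-plectic manifold: `η` is a smooth closed form of degree `n + 1`. -/
structure IsPrePlectic (n : ℕ) (η : Form E M (n + 1)) : Prop where
  smooth : η ∈ smoothForms E M (n + 1)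
  closed : extD η = 0

/-- `α`, of degree `d = n - 1`, is a Hamiltonian form on `(M, η)`. -/
def IsHamiltonian {n d : ℕ} (h : 1 + d = n) (η : Form E M (n + 1)) (α : Form E M d) : Prop :=
  ∃ X : VField E M, IsSmoothVField X ∧ extD α = -interior (by omega) X η

variable {L : Type*} [LieRing L] [LieAlgebra ℝ L]

/-- The multivector field `v_p`, where `v_{x₁ ∧ ⋯ ∧ xₖ} = v_{x₁} ∧ ⋯ ∧ v_{xₖ}`. -/
def multiField (v : ∀ m : M, L →ₗ[ℝ] TangentSpace 𝓘(ℝ, E) m) {k : ℕ} (p : ⋀[ℝ]^k L) (m : M) :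
    ⋀[ℝ]^k (TangentSpace 𝓘(ℝ, E) m) :=
  exteriorPower.map k (v m) p

/-- `x ↦ v_x` is a multisymplectic infinitesimal action of the Lie algebra `L` on `(M, η)`:
a Lie algebra homomorphism to the smooth vector fields on `M` that preserve `η`. -/
structure IsMultisymplecticAction {n : ℕ} (v : ∀ m : M, L →ₗ[ℝ] TangentSpace 𝓘(ℝ, E) m)
    (η : Form E M (n + 1)) : Prop where
  smooth : ∀ x, IsSmoothVField fun m => v m x
  map_lie : ∀ x y m, v m ⁅x, y⁆ =
    VectorField.mlieBracket 𝓘(ℝ, E) (fun m => v m x) (fun m => v m y) m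
  lieDerivative_eq_zero : ∀ x, lieDerivative (fun m => v m x) η = 0

variable (E M L) in
/-- Families of linear maps `f_i : Λ^i L → Ω^d(M)`, where `d = n - i`. -/
abbrev Components (n : ℕ) : Type _ :=
  ∀ i d : ℕ, i + d = n → (⋀[ℝ]^i L →ₗ[ℝ] smoothForms E M d)

/-- `f` is an `L_∞`-morphism from `L` to the observables of `(M, η)`: the image of `f_1` consists
of Hamiltonian forms, and `-f_{k-1}(∂q) = d f_k(q) + ς(k) ι(v_q) η` for `q ∈ Λᵏ L` and
`1 ≤ k ≤ n + 1`, where `f_0 = 0` and `f_{n+1} = 0`. The field `main` is the case `k = i + 1 ≤ n`,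
the field `top` the case `k = n + 1`. -/
structure IsLInftyMorphism {n : ℕ} (v : ∀ m : M, L →ₗ[ℝ] TangentSpace 𝓘(ℝ, E) m)
    (η : Form E M (n + 1)) (f : Components E M L n) : Prop where
  zero : ∀ d h, f 0 d h = 0
  hamiltonian : ∀ d (h : 1 + d = n) q, IsHamiltonian h η (f 1 d h q)
  main : ∀ i d (h : i + 1 + d = n) (q : ⋀[ℝ]^(i + 1) L),
    -(f i (d + 1) (by omega) (boundaryAt i q) : Form E M (d + 1)) =
      extD (f (i + 1) d h q : Form E M d) +
        varsigma (i + 1) • contract (by omega) (multiField v q) η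
  top : ∀ q : ⋀[ℝ]^(n + 1) L,
    -(f n 0 rfl (boundaryAt n q) : Form E M 0) =
      varsigma (n + 1) • contract rfl (multiField v q) η

/-- `f` is a homotopy co-momentum map for the infinitesimal action `v` on `(M, η)`. -/
structure IsCoMomentumMap {n : ℕ} (v : ∀ m : M, L →ₗ[ℝ] TangentSpace 𝓘(ℝ, E) m)
    (η : Form E M (n + 1)) (f : Components E M L n) : Prop where
  action : IsMultisymplecticAction v η
  morphism : IsLInftyMorphism v η f
  momentum : ∀ d (h : 1 + d = n) (x : L),
    extD (f 1 d h (exteriorPower.ιMulti ℝ 1 fun _ => x) : Form E M d) =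
      -interior (by omega) (fun m => v m x) η

/-- Equivariance of the components `f_i`, `1 ≤ i ≤ n`: `ρ_g^* (f_i q) = f_i (A_g q)`. -/
def IsEquivariant {K : Type*} {n : ℕ} (ρ : K → M → M) (A : K → L →ₗ[ℝ] L)
    (f : Components E M L n) : Prop :=
  ∀ g i d (h : i + d = n), 1 ≤ i → ∀ q : ⋀[ℝ]^i L,
    pullback (ρ g) (f i d h q : Form E M d) = f i d h (exteriorPower.map i (A g) q)

/-- `f^p_j(q) = -ς(k) f_{j+k}(q ∧ p)` for `j ≥ 1`, as maps on `Λ^j` of the isotropy algebra. -/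
def inducedComponents {n k r : ℕ} (hkr : k + r = n) (p : ⋀[ℝ]^k L) (f : Components E M L n) :
    Components E M (isotropyAlgebra p) r
  | 0, _, _ => 0
  | j + 1, d, h => -varsigma k • (f (j + 1 + k) d (by omega) ∘ₗ wedgeRight (j + 1) p ∘ₗ
      exteriorPower.map (j + 1) (isotropyAlgebra p).toSubmodule.subtype)

end Forms

section Group

variable {F : Type*} [NormedAddCommGroup F] [NormedSpace ℝ F] [CompleteSpace F]
  {G : Type*} [TopologicalSpace G] [ChartedSpace F G] [Group G]
  [LieGroup 𝓘(ℝ, F) ∞ G]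

instance lieGroup_minSmoothness : LieGroup 𝓘(ℝ, F) (minSmoothness ℝ 3) G := by
  rw [minSmoothness_of_isRCLikeNormedField]
  infer_instance

variable (F) in
/-- The adjoint action of `g`: the differential at `1` of `h ↦ g h g⁻¹`. -/
def Ad (g : G) : GroupLieAlgebra 𝓘(ℝ, F) G →ₗ[ℝ] GroupLieAlgebra 𝓘(ℝ, F) G :=
  (show F →L[ℝ] F from mfderiv 𝓘(ℝ, F) 𝓘(ℝ, F) (fun h : G => g * h * g⁻¹) 1).toLinearMap

theorem contMDiff_conj (g : G) :
    ContMDiff 𝓘(ℝ, F) 𝓘(ℝ, F) ∞ (fun h : G => g * h * g⁻¹) :=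
  (contMDiff_const.mul contMDiff_id).mul contMDiff_const

theorem mdifferentiableAt_conj (g h : G) :
    MDifferentiableAt 𝓘(ℝ, F) 𝓘(ℝ, F) (fun h : G => g * h * g⁻¹) h :=
  (contMDiff_conj g).mdifferentiable (by simp) h

theorem mdifferentiableAt_mulLeft (g h : G) :
    MDifferentiableAt 𝓘(ℝ, F) 𝓘(ℝ, F) (fun h : G => g * h) h :=
  (contMDiff_mul_left (n := ∞)).mdifferentiable (by simp) h

variable (F) in
/-- The differential of a map of `G` to itself, as an endomorphism of the model space, to which
all tangent spaces are equal by definition. -/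
def diffAt (φ : G → G) (g : G) : F →L[ℝ] F := mfderiv 𝓘(ℝ, F) 𝓘(ℝ, F) φ g

theorem diffAt_id (g : G) : diffAt F (id : G → G) g = ContinuousLinearMap.id ℝ F :=
  mfderiv_id

theorem diffAt_comp {φ ψ : G → G} (g : G) (hψ : MDifferentiableAt 𝓘(ℝ, F) 𝓘(ℝ, F) ψ (φ g))
    (hφ : MDifferentiableAt 𝓘(ℝ, F) 𝓘(ℝ, F) φ g) :
    diffAt F (fun x => ψ (φ x)) g = (diffAt F ψ (φ g)).comp (diffAt F φ g) :=
  mfderiv_comp (I' := 𝓘(ℝ, F)) g hψ hφ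

theorem Ad_apply (g : G) (x : GroupLieAlgebra 𝓘(ℝ, F) G) :
    Ad F g x = diffAt F (fun h : G => g * h * g⁻¹) 1 x := rfl

theorem Ad_one : Ad F (1 : G) = LinearMap.id := by
  have h : (fun h : G => (1 : G) * h * (1 : G)⁻¹) = id := by ext h; simp
  ext x
  rw [Ad_apply, h, diffAt_id]
  rfl

theorem diffAt_conj_comp (g h x : G) : diffAt F (fun x : G => g * h * x * (g * h)⁻¹) x =
    (diffAt F (fun x : G => g * x * g⁻¹) (h * x * h⁻¹)).comp
      (diffAt F (fun x : G => h * x * h⁻¹) x) := by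
  rw [← diffAt_comp x (mdifferentiableAt_conj _ _) (mdifferentiableAt_conj _ _)]
  congr 1
  ext x; simp [mul_assoc]

theorem Ad_mul (g h : G) : Ad F (g * h) = Ad F g ∘ₗ Ad F h := by
  ext x
  rw [Ad_apply, diffAt_conj_comp, mul_one, mul_inv_cancel]
  rfl

theorem diffAt_conj_inverse (g h : G) :
    (diffAt F (fun x : G => g * x * g⁻¹) h).inverse =
      diffAt F (fun x : G => g⁻¹ * x * g⁻¹⁻¹) (g * h * g⁻¹) := by
  have e : (fun h : G => (1 : G) * h * (1 : G)⁻¹) = id := by ext h; simp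
  have e3 : g⁻¹ * (g * h * g⁻¹) * g⁻¹⁻¹ = h := by simp [mul_assoc]
  have d1 := diffAt_conj_comp (F := F) g⁻¹ g h
  have d2 := diffAt_conj_comp (F := F) g g⁻¹ (g * h * g⁻¹)
  rw [inv_mul_cancel, e, diffAt_id] at d1
  rw [mul_inv_cancel, e, diffAt_id, e3] at d2
  exact ContinuousLinearMap.inverse_eq d2.symm d1.symm

theorem mpullback_conj (g : G) (x : GroupLieAlgebra 𝓘(ℝ, F) G) :
    VectorField.mpullback 𝓘(ℝ, F) 𝓘(ℝ, F) (fun h : G => g * h * g⁻¹)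
      (mulInvariantVectorField (Ad F g x)) = mulInvariantVectorField x := by
  ext h
  change (diffAt F (fun x : G => g * x * g⁻¹) h).inverse
    (diffAt F (fun y : G => g * h * g⁻¹ * y) 1 (diffAt F (fun h : G => g * h * g⁻¹) 1 x)) =
      diffAt F (fun y : G => h * y) 1 x
  have e1 : g * (1 : G) * g⁻¹ = 1 := by simp
  have d1 := diffAt_comp (F := F) (1 : G) (mdifferentiableAt_mulLeft (g * h * g⁻¹) (g * 1 * g⁻¹))
    (mdifferentiableAt_conj g 1)
  have d2 := diffAt_comp (F := F) (1 : G) (mdifferentiableAt_conj g (h * 1))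
    (mdifferentiableAt_mulLeft h 1)
  have e2 : (fun x : G => g * h * g⁻¹ * (g * x * g⁻¹)) = fun x => g * (h * x) * g⁻¹ := by
    ext x; simp [mul_assoc]
  rw [e1] at d1
  rw [mul_one] at d2
  rw [e2, d2] at d1
  have d3 := diffAt_conj_comp (F := F) g⁻¹ g h
  have e : (fun h : G => (1 : G) * h * (1 : G)⁻¹) = id := by ext h; simp
  rw [inv_mul_cancel, e, diffAt_id] at d3
  rw [diffAt_conj_inverse]
  exact (congrArg (diffAt F (fun x : G => g⁻¹ * x * g⁻¹⁻¹) (g * h * g⁻¹))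
    (DFunLike.congr_fun d1 (x : F)).symm).trans
      (DFunLike.congr_fun d3 (diffAt F (fun y : G => h * y) 1 (x : F))).symm

theorem Ad_lie (g : G) (x y : GroupLieAlgebra 𝓘(ℝ, F) G) :
    Ad F g ⁅x, y⁆ = ⁅Ad F g x, Ad F g y⁆ := by
  have e1 : g * (1 : G) * g⁻¹ = 1 := by simp
  have key : ∀ (Z : ∀ h : G, TangentSpace 𝓘(ℝ, F) h), (VectorField.mpullback 𝓘(ℝ, F) 𝓘(ℝ, F)
      (fun h : G => g * h * g⁻¹) Z (1 : G) : F) = Ad F g⁻¹ (Z 1) := by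
    intro Z
    have h1 : (VectorField.mpullback 𝓘(ℝ, F) 𝓘(ℝ, F) (fun h : G => g * h * g⁻¹) Z (1 : G) : F) =
      (diffAt F (fun x : G => g * x * g⁻¹) 1).inverse (Z (g * 1 * g⁻¹) : F) := rfl
    rw [h1, diffAt_conj_inverse, e1]
    rfl
  have h : ⁅x, y⁆ = Ad F g⁻¹ ⁅Ad F g x, Ad F g y⁆ := by
    rw [GroupLieAlgebra.bracket_def, GroupLieAlgebra.bracket_def, ← key,
      VectorField.mpullback_mlieBracket (n := ∞)
        (mdifferentiableAt_mulInvariantVectorField _) (mdifferentiableAt_mulInvariantVectorField _)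
        (contMDiff_conj g 1) (by rw [minSmoothness_of_isRCLikeNormedField]; exact ENat.LEInfty.out),
      mpullback_conj, mpullback_conj]
  rw [h, ← LinearMap.comp_apply, ← Ad_mul, mul_inv_cancel, Ad_one, LinearMap.id_apply]

/-- The isotropy group `G_p` for the adjoint action of `G` on `Λᵏ 𝔤`. -/
def isotropyGroup {k : ℕ} (p : ⋀[ℝ]^k (GroupLieAlgebra 𝓘(ℝ, F) G)) : Subgroup G where
  carrier := {g | exteriorPower.map k (Ad F g) p = p}
  one_mem' := by
    change exteriorPower.map k (Ad F 1) p = p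
    rw [Ad_one, exteriorPower.map_id, LinearMap.id_apply]
  mul_mem' {g h} hg hh := by
    change exteriorPower.map k (Ad F g) p = p at hg
    change exteriorPower.map k (Ad F h) p = p at hh
    change exteriorPower.map k (Ad F (g * h)) p = p
    rw [Ad_mul, exteriorPower.map_comp, LinearMap.comp_apply, hh, hg]
  inv_mem' {g} hg := by
    change exteriorPower.map k (Ad F g) p = p at hg
    change exteriorPower.map k (Ad F g⁻¹) p = p
    conv_lhs => rw [← hg]
    rw [← LinearMap.comp_apply, ← exteriorPower.map_comp, ← Ad_mul, inv_mul_cancel, Ad_one,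
      exteriorPower.map_id, LinearMap.id_apply]

/-- The connected component `G_p^0` of the identity in `G_p`, as a subgroup of `G`. -/
def isotropyComponent {k : ℕ} (p : ⋀[ℝ]^k (GroupLieAlgebra 𝓘(ℝ, F) G)) : Subgroup G :=
  haveI : IsTopologicalGroup G := topologicalGroup_of_lieGroup 𝓘(ℝ, F) ∞
  (Subgroup.connectedComponentOfOne (isotropyGroup p)).map (isotropyGroup p).subtype

theorem isotropyComponent_le {k : ℕ} (p : ⋀[ℝ]^k (GroupLieAlgebra 𝓘(ℝ, F) G)) :
    isotropyComponent p ≤ isotropyGroup p := by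
  rintro _ ⟨g, _, rfl⟩
  exact g.2

theorem Ad_mem_isotropyAlgebra {k : ℕ} (p : ⋀[ℝ]^k (GroupLieAlgebra 𝓘(ℝ, F) G)) {g : G}
    (hg : g ∈ isotropyGroup p) {x : GroupLieAlgebra 𝓘(ℝ, F) G} (hx : x ∈ isotropyAlgebra p) :
    Ad F g x ∈ isotropyAlgebra p := by
  rw [mem_isotropyAlgebra] at hx ⊢
  have hg' : exteriorPower.map k (Ad F g) p = p := hg
  have h := congrArg (fun q : ⋀[ℝ]^k (GroupLieAlgebra 𝓘(ℝ, F) G) =>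
    (q : ExteriorAlgebra ℝ (GroupLieAlgebra 𝓘(ℝ, F) G))) hg'
  simp only [coe_exteriorPower_map] at h
  rw [← h, adExt_map _ (Ad_lie g), hx, map_zero]

/-- The adjoint action of `G_p^0` on the isotropy algebra `𝔤_p`. -/
def isotropyAd {k : ℕ} (p : ⋀[ℝ]^k (GroupLieAlgebra 𝓘(ℝ, F) G)) (g : isotropyComponent p) :
    isotropyAlgebra p →ₗ[ℝ] isotropyAlgebra p :=
  (Ad F (g : G)).restrict (p := (isotropyAlgebra p).toSubmodule)
    (q := (isotropyAlgebra p).toSubmodule)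
    fun _ hx => Ad_mem_isotropyAlgebra p (isotropyComponent_le p g.2) hx

variable {E : Type*} [NormedAddCommGroup E] [NormedSpace ℝ E]
  {M : Type*} [TopologicalSpace M] [ChartedSpace E M] [IsManifold 𝓘(ℝ, E) ∞ M]

variable (F E G M) in
/-- A smooth right action of the Lie group `G` on the manifold `M`. -/
structure SmoothRightAction where
  act : M → G → M
  act_one : ∀ m, act m 1 = m
  act_mul : ∀ m g h, act m (g * h) = act (act m g) h
  smooth : ContMDiff (𝓘(ℝ, E).prod 𝓘(ℝ, F)) 𝓘(ℝ, E) ∞ (fun q : M × G => act q.1 q.2)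

/-- The infinitesimal action `v_x(m) = d/dt|₀ m·exp(tx)`, i.e. the image of `x` under the
differential at `1` of `g ↦ m·g`. -/
def SmoothRightAction.infinitesimal (ϑ : SmoothRightAction F G E M) (m : M) :
    GroupLieAlgebra 𝓘(ℝ, F) G →ₗ[ℝ] TangentSpace 𝓘(ℝ, E) m :=
  (show F →L[ℝ] E from mfderiv 𝓘(ℝ, F) 𝓘(ℝ, E) (fun g : G => ϑ.act m g) 1).toLinearMap

/-- The restriction of an infinitesimal action to a Lie subalgebra. -/
def restrictAction {L : Type*} [LieRing L] [LieAlgebra ℝ L] (S : LieSubalgebra ℝ L)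
    (v : ∀ m : M, L →ₗ[ℝ] TangentSpace 𝓘(ℝ, E) m) (m : M) : S →ₗ[ℝ] TangentSpace 𝓘(ℝ, E) m :=
  v m ∘ₗ S.toSubmodule.subtype

end Group
end
end Multisymplectic

/-! The algebraic core is the identity `∂(q ∧ p) = ∂q ∧ p` for `q ∈ Λ 𝔤_p`
(`boundary_map_subtype_mul`). It follows from the recursion `∂(x ∧ a) = -x ∧ ∂a - [x, a]`, because
`∂p = 0` and every `x ∈ 𝔤_p` satisfies `[x, p] = 0`. Successive contraction gives `ι(v_q) ι(v_p) ω =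
(-1)^{jk} ι(v_{q ∧ p}) ω`, and the signs satisfy `-ς(k) ς(j+k) = (-1)^{jk} ς(j)`. Hence the relation
of `f` in degree `j + k` at `q ∧ p`, multiplied by `-ς(k)`, is the relation of `f^p` in degree `j`
at `q`.

The remaining co-momentum statements come from the same relations. At `p` itself the relation reads
`ι(v_p) ω = -ς(k) d f_k(p)`, so `ι(v_p) ω` is exact, hence smooth and closed. In degree one it shows
that `ι_{v_x} ι(v_p) ω` is closed, so the Lie derivative of `ι(v_p) ω` along `v_x` vanishes for `x ∈
𝔤_p`.

Invariance under `G_p^0` is proved without flows and without a Lie group structure on `G_p`.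
Translations satisfy `ϑ_g^* ι(v_p) ω = ι(v_{Ad_g p}) ϑ_g^* ω`, so it is enough that `ϑ_g^* ω = ω`
when `g` lies in a connected set through `1`. The functions `g ↦ (ϑ_g^* ω)_m(w)` are locally
constant on `G` (`pullbackEval_isLocallyConstant`): their differential at `1` vanishes because `ω`,
pulled back along the action, is closed and so are all `ι_{v_x} ω` (`fderiv_slice_eq_zero`), and
translation in `G` carries this to every `g`.

Equivariance holds because `Ad_g (q ∧ p) = Ad_g q ∧ p` for `g ∈ G_p`. -/

set_option linter.unusedSectionVars false
open scoped Manifold ContDiff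

namespace Multisymplectic
noncomputable section

/-! ### Exterior algebra: the boundary of `q ∧ p`, iterated contractions and signs. -/

section ExteriorAlgebra

variable {V : Type*} [AddCommGroup V] [Module ℝ V]
  {L : Type*} [LieRing L] [LieAlgebra ℝ L]

theorem adExt_one (x : L) : adExt x (1 : ExteriorAlgebra ℝ L) = 0 := extendDerivation_one _

/-- `[x, ·]` is a derivation of the exterior algebra. -/
theorem adExt_mul (x : L) (a b : ExteriorAlgebra ℝ L) :
    adExt x (a * b) = adExt x a * b + a * adExt x b := by
  induction a using exterior_induction with
  | h1 => simp [adExt_one]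
  | hadd a c ha hc => simp only [map_add, add_mul, ha, hc]; abel
  | hsmul s a ha => simp only [map_smul, smul_mul_assoc, ha, smul_add]
  | hmul z a ha => rw [mul_assoc, adExt_ι_mul, ha, adExt_ι_mul]; noncomm_ring

/-- If `p` is a cycle, then wedging with `p` commutes with the Lie algebra homology differential
on the exterior algebra of the isotropy algebra of `p`. -/
theorem boundary_map_subtype_mul {k : ℕ} (p : ⋀[ℝ]^k L)
    (hp : boundary (p : ExteriorAlgebra ℝ L) = 0) (q : ExteriorAlgebra ℝ (isotropyAlgebra p)) :
    boundary (ExteriorAlgebra.map (isotropyAlgebra p).toSubmodule.subtype q *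
        (p : ExteriorAlgebra ℝ L)) =
      ExteriorAlgebra.map (isotropyAlgebra p).toSubmodule.subtype (boundary q) *
        (p : ExteriorAlgebra ℝ L) := by
  induction q using exterior_induction with
  | h1 => simp [hp, boundary_one]
  | hadd a c ha hc => simp only [map_add, add_mul, ha, hc]
  | hsmul s a ha => simp only [map_smul, smul_mul_assoc, ha]
  | hmul z a ha =>
    -- By the Leibniz rule and `[z, p] = 0`, the bracket `[z, a ∧ p]` is `[z, a] ∧ p`, so both sides
    -- obey the same recursion in `z`.
    have hz : adExt (z : L) (p : ExteriorAlgebra ℝ L) = 0 := z.2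
    have hm := adExt_map (isotropyAlgebra p).toSubmodule.subtype (fun _ _ => rfl) z a
    have hz' : (isotropyAlgebra p).toSubmodule.subtype z = (z : L) := rfl
    rw [hz'] at hm
    rw [map_mul (ExteriorAlgebra.map _), ExteriorAlgebra.map_apply_ι, hz', mul_assoc, boundary_ι_mul, ha, adExt_mul, hz, hm,
      boundary_ι_mul, map_sub, map_neg, map_mul (ExteriorAlgebra.map _), ExteriorAlgebra.map_apply_ι, hz']
    noncomm_ring

theorem ι_mul_ιMulti (x : V) {k : ℕ} (y : Fin k → V) :
    ExteriorAlgebra.ι ℝ x * ExteriorAlgebra.ιMulti ℝ k y =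
      (-1 : ℝ) ^ k • (ExteriorAlgebra.ιMulti ℝ k y * ExteriorAlgebra.ι ℝ x) := by
  induction k with
  | zero => simp
  | succ k ih =>
    rw [ExteriorAlgebra.ιMulti_succ_apply, ι_mul_ι_mul, ih, mul_smul_comm, mul_assoc, pow_succ,
      mul_neg_one, neg_smul]

theorem ι_mul_eq_of_mem (x : V) {k : ℕ} {b : ExteriorAlgebra ℝ V} (hb : b ∈ ⋀[ℝ]^k V) :
    ExteriorAlgebra.ι ℝ x * b = (-1 : ℝ) ^ k • (b * ExteriorAlgebra.ι ℝ x) := by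
  rw [← ExteriorAlgebra.ιMulti_span_fixedDegree] at hb
  induction hb using Submodule.span_induction with
  | zero => simp
  | add a b _ _ ha hb => rw [mul_add, add_mul, ha, hb, smul_add]
  | smul r a _ ha => rw [mul_smul_comm, ha, smul_mul_assoc, smul_comm]
  | mem a ha => obtain ⟨y, rfl⟩ := ha; exact ι_mul_ιMulti x y

/-- Graded commutativity of the exterior algebra. -/
theorem mul_eq_smul_mul_of_mem {j k : ℕ} {a b : ExteriorAlgebra ℝ V} (ha : a ∈ ⋀[ℝ]^j V)
    (hb : b ∈ ⋀[ℝ]^k V) : a * b = (-1 : ℝ) ^ (j * k) • (b * a) := by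
  rw [← ExteriorAlgebra.ιMulti_span_fixedDegree] at ha
  induction ha using Submodule.span_induction with
  | zero => simp
  | add a c _ _ ha hc => rw [mul_add, add_mul, ha, hc, smul_add]
  | smul r a _ ha => rw [mul_smul_comm, smul_mul_assoc, ha, smul_comm]
  | mem a ha =>
    obtain ⟨y, rfl⟩ := ha
    induction j with
    | zero => simp
    | succ j ih =>
      rw [ExteriorAlgebra.ιMulti_succ_apply, mul_assoc, ih, mul_smul_comm, ← mul_assoc,
        ι_mul_eq_of_mem _ hb, smul_mul_assoc, smul_smul, ← pow_add, mul_assoc]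
      congr 2
      ring

theorem ιMulti_mul_ιMulti {j k : ℕ} (x : Fin j → V) (y : Fin k → V) :
    ExteriorAlgebra.ιMulti ℝ j x * ExteriorAlgebra.ιMulti ℝ k y =
      ExteriorAlgebra.ιMulti ℝ (j + k) (Fin.append x y) := by
  have h : (fun i => ExteriorAlgebra.ι ℝ (Fin.append x y i)) =
      Fin.append (fun i => ExteriorAlgebra.ι ℝ (x i)) fun i => ExteriorAlgebra.ι ℝ (y i) := by
    ext i
    refine Fin.addCases (fun i => ?_) (fun i => ?_) i <;> simp
  rw [ExteriorAlgebra.ιMulti_apply, ExteriorAlgebra.ιMulti_apply, ExteriorAlgebra.ιMulti_apply, h,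
    List.ofFn_fin_append, List.prod_append]

theorem coe_wedgeRight (j : ℕ) {k : ℕ} (p : ⋀[ℝ]^k V) (q : ⋀[ℝ]^j V) :
    (wedgeRight j p q : ExteriorAlgebra ℝ V) = q * p := rfl

theorem coe_boundaryAt (k : ℕ) (q : ⋀[ℝ]^(k + 1) L) :
    (boundaryAt k q : ExteriorAlgebra ℝ L) = boundary (q : ExteriorAlgebra ℝ L) := rfl

theorem boundary_eq_zero_of_mem_one {q : ExteriorAlgebra ℝ L} (hq : q ∈ ⋀[ℝ]^1 L) :
    boundary q = 0 := by
  rw [← ExteriorAlgebra.ιMulti_span_fixedDegree] at hq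
  induction hq using Submodule.span_induction with
  | zero => simp
  | add a c _ _ ha hc => rw [map_add, ha, hc, add_zero]
  | smul r a _ ha => rw [map_smul, ha, smul_zero]
  | mem a ha =>
    obtain ⟨y, rfl⟩ := ha
    rw [ExteriorAlgebra.ιMulti_succ_apply, boundary_ι_mul]
    simp [boundary_one, adExt_one]

theorem boundaryAt_zero : (boundaryAt 0 : ⋀[ℝ]^(0 + 1) L →ₗ[ℝ] ⋀[ℝ]^0 L) = 0 := by
  refine LinearMap.ext fun q => ?_
  exact Subtype.ext (boundary_eq_zero_of_mem_one q.2)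

/-- The Hamiltonian condition quantifies over `Λ¹` and the momentum condition over vectors; this
passes from one to the other. -/
theorem exists_eq_ιMulti_one (q : ⋀[ℝ]^1 V) : ∃ x : V, q = exteriorPower.ιMulti ℝ 1 fun _ => x := by
  obtain ⟨q, hq⟩ := q
  have h : ∃ x : V, q = ExteriorAlgebra.ι ℝ x := by
    rw [← ExteriorAlgebra.ιMulti_span_fixedDegree] at hq
    induction hq using Submodule.span_induction with
    | zero => exact ⟨0, by simp⟩
    | add a c _ _ ha hc =>
      obtain ⟨x, rfl⟩ := ha
      obtain ⟨y, rfl⟩ := hc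
      exact ⟨x + y, by simp⟩
    | smul r a _ ha =>
      obtain ⟨x, rfl⟩ := ha
      exact ⟨r • x, by simp⟩
    | mem a ha =>
      obtain ⟨y, rfl⟩ := ha
      exact ⟨y 0, by rw [ExteriorAlgebra.ιMulti_succ_apply]; simp⟩
  obtain ⟨x, rfl⟩ := h
  refine ⟨x, Subtype.ext ?_⟩
  rw [exteriorPower.ιMulti_apply_coe, ExteriorAlgebra.ιMulti_succ_apply]
  simp

/-- Induction principle for exterior powers: they are spanned by the decomposable elements. -/
theorem exteriorPower_induction {k : ℕ} {P : ⋀[ℝ]^k V → Prop} (hzero : P 0)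
    (hadd : ∀ a b, P a → P b → P (a + b)) (hsmul : ∀ (r : ℝ) a, P a → P (r • a))
    (hι : ∀ x, P (exteriorPower.ιMulti ℝ k x)) (q : ⋀[ℝ]^k V) : P q := by
  have h : q ∈ Submodule.span ℝ (Set.range (exteriorPower.ιMulti ℝ k (M := V))) := by
    rw [exteriorPower.ιMulti_span]; trivial
  induction h using Submodule.span_induction with
  | zero => exact hzero
  | add a b _ _ ha hb => exact hadd a b ha hb
  | smul r a _ ha => exact hsmul r a ha
  | mem a ha => obtain ⟨x, rfl⟩ := ha; exact hι x

theorem wedgeRight_ιMulti {j k : ℕ} (x : Fin j → V) (y : Fin k → V) :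
    wedgeRight j (exteriorPower.ιMulti ℝ k y) (exteriorPower.ιMulti ℝ j x) =
      exteriorPower.ιMulti ℝ (j + k) (Fin.append x y) :=
  Subtype.ext <| by
    rw [coe_wedgeRight, exteriorPower.ιMulti_apply_coe, exteriorPower.ιMulti_apply_coe,
      exteriorPower.ιMulti_apply_coe, ιMulti_mul_ιMulti]

theorem map_wedgeRight {W : Type*} [AddCommGroup W] [Module ℝ W] (A : V →ₗ[ℝ] W) {j k : ℕ}
    (p : ⋀[ℝ]^k V) (q : ⋀[ℝ]^j V) : exteriorPower.map (j + k) A (wedgeRight j p q) =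
      wedgeRight j (exteriorPower.map k A p) (exteriorPower.map j A q) :=
  Subtype.ext <| by simp only [coe_exteriorPower_map, coe_wedgeRight, map_mul]

section Contraction

variable [TopologicalSpace V]

/-- Each contraction fills the first free slots of the form. Thus `P` occupies the leading slots and
`Q` the next ones, and the product is `P ∧ Q`, which is `wedgeRight k Q P`. Both sides are linear in
`P` and `Q`, so decomposable elements suffice. -/
theorem contractMulti_contractMulti {N N' j k e : ℕ} (h : k + N' = N) (h' : j + e = N')
    (h'' : k + j + e = N) (η : V [⋀^Fin N]→L[ℝ] ℝ) (P : ⋀[ℝ]^k V) (Q : ⋀[ℝ]^j V) :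
    contractMulti h' (contractMulti h η P) Q = contractMulti h'' η (wedgeRight k Q P) := by
  induction Q using exteriorPower_induction with
  | hzero =>
    have : wedgeRight k (0 : ⋀[ℝ]^j V) P = 0 := Subtype.ext (mul_zero _)
    rw [map_zero, this, map_zero]
  | hadd a b ha hb =>
    have : wedgeRight k (a + b) P = wedgeRight k a P + wedgeRight k b P :=
      Subtype.ext (mul_add _ _ _)
    rw [map_add, ha, hb, this, map_add]
  | hsmul r a ha =>
    have : wedgeRight k (r • a) P = r • wedgeRight k a P := Subtype.ext (mul_smul_comm _ _ _)
    rw [map_smul, ha, this, map_smul]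
  | hι y =>
    ext w
    induction P using exteriorPower_induction with
    | hzero => rw [map_zero, map_zero, map_zero, contractMulti_ιMulti]; rfl
    | hadd a b ha hb =>
      rw [contractMulti_ιMulti] at ha hb ⊢
      rw [map_add, map_add, map_add, ContinuousAlternatingMap.add_apply,
        ContinuousAlternatingMap.add_apply, ha, hb]
    | hsmul r a ha =>
      rw [contractMulti_ιMulti] at ha ⊢
      rw [map_smul, map_smul, map_smul, ContinuousAlternatingMap.smul_apply,
        ContinuousAlternatingMap.smul_apply, ha]
    | hι x =>
      rw [contractMulti_ιMulti, contractMulti_ιMulti, wedgeRight_ιMulti, contractMulti_ιMulti]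
      subst h' h
      congr 1
      ext i
      simp only [Function.comp_apply, Fin.append_assoc]
      simp

/-- The powers `Λ^{k+j}` and `Λ^{j+k}` are different types, so their elements are compared in the
full exterior algebra. -/
theorem contractMulti_congr_coe {N a b e : ℕ} (ha : a + e = N) (hb : b + e = N)
    (η : V [⋀^Fin N]→L[ℝ] ℝ) (c : ℝ) (P : ⋀[ℝ]^a V) (Q : ⋀[ℝ]^b V)
    (h : (P : ExteriorAlgebra ℝ V) = c • (Q : ExteriorAlgebra ℝ V)) :
    contractMulti ha η P = c • contractMulti hb η Q := by
  obtain rfl : a = b := by omega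
  obtain rfl : P = c • Q := Subtype.ext h
  rw [map_smul]

/-- Puts `p` behind `q`, as in the formula for `f^p`; the sign is that of graded commutativity. -/
theorem contractMulti_contractMulti_swap {N N' j k e : ℕ} (h : k + N' = N) (h' : j + e = N')
    (h'' : j + k + e = N) (η : V [⋀^Fin N]→L[ℝ] ℝ) (P : ⋀[ℝ]^k V) (Q : ⋀[ℝ]^j V) :
    contractMulti h' (contractMulti h η P) Q =
      (-1 : ℝ) ^ (j * k) • contractMulti h'' η (wedgeRight j P Q) := by
  rw [contractMulti_contractMulti h h' (by omega)]
  refine contractMulti_congr_coe _ _ _ _ _ _ ?_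
  rw [coe_wedgeRight, coe_wedgeRight, mul_eq_smul_mul_of_mem P.2 Q.2, mul_comm k j]

theorem contractMulti_compContinuousLinearMap {W : Type*} [AddCommGroup W] [Module ℝ W]
    [TopologicalSpace W] {N k e : ℕ} (h : k + e = N) (η : W [⋀^Fin N]→L[ℝ] ℝ) (A : V →L[ℝ] W)
    (P : ⋀[ℝ]^k V) :
    contractMulti h (η.compContinuousLinearMap A) P =
      (contractMulti h η (exteriorPower.map k (A : V →ₗ[ℝ] W) P)).compContinuousLinearMap A := by
  ext w
  induction P using exteriorPower_induction with
  | hzero => simp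
  | hadd a b ha hb =>
    rw [map_add, map_add, map_add, ContinuousAlternatingMap.add_apply, ha, hb]; rfl
  | hsmul r a ha =>
    rw [map_smul, map_smul, map_smul, ContinuousAlternatingMap.smul_apply, ha]; rfl
  | hι x =>
    rw [contractMulti_ιMulti, exteriorPower.map_apply_ιMulti]
    simp only [ContinuousAlternatingMap.compContinuousLinearMap_apply]
    rw [contractMulti_ιMulti]
    subst h
    congr 1
    ext i
    refine Fin.addCases (fun i => ?_) (fun i => ?_) i <;> simp

end Contraction

theorem varsigma_mul_self (k : ℕ) : varsigma k * varsigma k = 1 := by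
  simp [varsigma, ← mul_pow]

/-- The triangular numbers `T(i) = i(i+1)/2` satisfy `T(j+k) = T(j) + T(k) + jk`. The term `jk`
produces the sign that reordering the two contractions absorbs. -/
theorem varsigma_add (j k : ℕ) :
    varsigma (j + k) = -(varsigma j * varsigma k * (-1) ^ (j * k)) := by
  have h : (j + k) * (j + k + 1) / 2 = j * (j + 1) / 2 + k * (k + 1) / 2 + j * k := by
    obtain ⟨a, ha⟩ := (Nat.even_mul_succ_self j).two_dvd
    obtain ⟨b, hb⟩ := (Nat.even_mul_succ_self k).two_dvd
    have h1 : (j + k) * (j + k + 1) = 2 * (a + b + j * k) := by linear_combination ha + hb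
    rw [h1, ha, hb]
    simp
  rw [varsigma, varsigma, varsigma, h]
  ring

theorem varsigma_one : varsigma 1 = 1 := by simp [varsigma]

end ExteriorAlgebra

/-! ### Differentials of maps of manifolds and naturality of the exterior derivative. -/

section Differential

variable {E : Type*} [NormedAddCommGroup E] [NormedSpace ℝ E]
  {M : Type*} [TopologicalSpace M] [ChartedSpace E M]
  {F : Type*} [NormedAddCommGroup F] [NormedSpace ℝ F]
  {X : Type*} [TopologicalSpace X] [ChartedSpace F X]
  {H : Type*} [NormedAddCommGroup H] [NormedSpace ℝ H]
  {Y : Type*} [TopologicalSpace Y] [ChartedSpace H Y]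

variable (E F) in
/-- The differential of a map of manifolds, as a continuous linear map between the model spaces, to
which the tangent spaces are equal by definition. -/
def differential (φ : X → M) (z : X) : F →L[ℝ] E := mfderiv 𝓘(ℝ, F) 𝓘(ℝ, E) φ z

theorem differential_comp {φ : X → M} {ψ : Y → X} (z : Y)
    (hφ : MDifferentiableAt 𝓘(ℝ, F) 𝓘(ℝ, E) φ (ψ z))
    (hψ : MDifferentiableAt 𝓘(ℝ, H) 𝓘(ℝ, F) ψ z) :
    differential E H (fun y => φ (ψ y)) z =
      (differential E F φ (ψ z)).comp (differential F H ψ z) :=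
  mfderiv_comp (I' := 𝓘(ℝ, F)) z hφ hψ

theorem differential_congr {φ ψ : X → M} {z : X} (h : φ =ᶠ[nhds z] ψ) :
    differential E F φ z = differential E F ψ z :=
  h.mfderiv_eq

theorem differential_id (z : X) : differential F F (fun y : X => y) z = ContinuousLinearMap.id ℝ F :=
  mfderiv_id

theorem differential_eq_fderiv (φ : F → E) (z : F) : differential E F φ z = fderiv ℝ φ z :=
  mfderiv_eq_fderiv

section

variable [IsManifold 𝓘(ℝ, E) ∞ M]

theorem contMDiffAt_extChartAt_symm (m : M) {y : E} (hy : y ∈ (extChartAt 𝓘(ℝ, E) m).target) :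
    ContMDiffAt 𝓘(ℝ, E) 𝓘(ℝ, E) ∞ (extChartAt 𝓘(ℝ, E) m).symm y :=
  (contMDiffOn_extChartAt_symm m).contMDiffAt ((isOpen_extChartAt_target m).mem_nhds hy)

theorem contMDiffAt_extChartAt_of_mem (m : M) {m' : M} (hm : m' ∈ (extChartAt 𝓘(ℝ, E) m).source) :
    ContMDiffAt 𝓘(ℝ, E) 𝓘(ℝ, E) ∞ (extChartAt 𝓘(ℝ, E) m) m' :=
  contMDiffAt_extChartAt' (by rwa [← extChartAt_source 𝓘(ℝ, E)])

theorem differential_extChartAt_symm_comp (m : M) {m' : M}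
    (hm : m' ∈ (extChartAt 𝓘(ℝ, E) m).source) :
    (differential E E (extChartAt 𝓘(ℝ, E) m).symm (extChartAt 𝓘(ℝ, E) m m')).comp
      (differential E E (extChartAt 𝓘(ℝ, E) m) m') = ContinuousLinearMap.id ℝ E := by
  rw [← differential_comp m' ((contMDiffAt_extChartAt_symm m
    ((extChartAt 𝓘(ℝ, E) m).map_source hm)).mdifferentiableAt (by simp))
    ((contMDiffAt_extChartAt_of_mem m hm).mdifferentiableAt (by simp)),
    ← differential_id (F := E) m']
  refine differential_congr ?_
  filter_upwards [(isOpen_extChartAt_source m).mem_nhds hm] with z hz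
  exact (extChartAt 𝓘(ℝ, E) m).left_inv hz

theorem differential_extChartAt_comp_symm (m : M) {y : E}
    (hy : y ∈ (extChartAt 𝓘(ℝ, E) m).target) :
    (differential E E (extChartAt 𝓘(ℝ, E) m) ((extChartAt 𝓘(ℝ, E) m).symm y)).comp
      (differential E E (extChartAt 𝓘(ℝ, E) m).symm y) = ContinuousLinearMap.id ℝ E := by
  rw [← differential_comp y ((contMDiffAt_extChartAt_of_mem m
    ((extChartAt 𝓘(ℝ, E) m).map_target hy)).mdifferentiableAt (by simp))
    ((contMDiffAt_extChartAt_symm m hy).mdifferentiableAt (by simp)),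
    ← differential_id (F := E) y]
  refine differential_congr ?_
  filter_upwards [(isOpen_extChartAt_target m).mem_nhds hy] with z hz
  exact (extChartAt 𝓘(ℝ, E) m).right_inv hz

end

/-- A real function with vanishing differential is locally constant. -/
theorem isLocallyConstant_of_differential_eq_zero [IsManifold 𝓘(ℝ, F) ∞ X] {u : X → ℝ}
    (hu : ∀ z, MDifferentiableAt 𝓘(ℝ, F) 𝓘(ℝ, ℝ) u z) (hu' : ∀ z, differential ℝ F u z = 0) :
    IsLocallyConstant u := by
  rw [IsLocallyConstant.iff_eventually_eq]
  intro z
  set χ := extChartAt 𝓘(ℝ, F) z with hχ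
  have hz : χ z ∈ χ.target := mem_extChartAt_target z
  -- The chart target need not be connected, so the argument is confined to a ball inside it.
  obtain ⟨ε, hε, hball⟩ := Metric.isOpen_iff.1 (isOpen_extChartAt_target (I := 𝓘(ℝ, F)) z) _ hz
  have hd : ∀ y ∈ χ.target, MDifferentiableAt 𝓘(ℝ, F) 𝓘(ℝ, ℝ) (fun y => u (χ.symm y)) y :=
    fun y hy => (hu _).comp y ((contMDiffAt_extChartAt_symm z hy).mdifferentiableAt (by simp))
  have hd0 : ∀ y ∈ χ.target, fderiv ℝ (fun y => u (χ.symm y)) y = 0 := by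
    intro y hy
    rw [← differential_eq_fderiv, differential_comp (F := F) y (hu _)
      ((contMDiffAt_extChartAt_symm z hy).mdifferentiableAt (by simp)), hu',
      ContinuousLinearMap.zero_comp]
  have hc : Filter.Tendsto χ (nhds z) (nhds (χ z)) := continuousAt_extChartAt z
  filter_upwards [hc (Metric.ball_mem_nhds _ hε), (isOpen_extChartAt_source (I := 𝓘(ℝ, F))
    z).mem_nhds (mem_extChartAt_source z)] with z' hz' hs
  have := Metric.isOpen_ball.is_const_of_fderiv_eq_zero (convex_ball (χ z) ε).isPreconnected
    (f := fun y => u (χ.symm y))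
    (fun y hy => ((hd y (hball hy)).differentiableAt).differentiableWithinAt)
    (fun y hy => hd0 y (hball hy)) hz' (Metric.mem_ball_self hε)
  simpa only [χ.left_inv hs, χ.left_inv (mem_extChartAt_source z)] using this

variable [IsManifold 𝓘(ℝ, E) ∞ M]

/-- The value of a form at a point, as a form on the model space. -/
def formAt {d : ℕ} (α : Form E M d) (m : M) : E [⋀^Fin d]→L[ℝ] ℝ := α m

/-- The pullback of a form on `M` to a normed space. -/
def pullbackToModel {d : ℕ} (Φ : H → M) (α : Form E M d) (z : H) : H [⋀^Fin d]→L[ℝ] ℝ :=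
  (formAt α (Φ z)).compContinuousLinearMap (differential E H Φ z)

theorem inChart_eq_pullbackToModel {d : ℕ} (α : Form E M d) (m : M) :
    inChart α m = pullbackToModel (extChartAt 𝓘(ℝ, E) m).symm α := rfl

theorem pullbackToModel_apply {d : ℕ} (Φ : H → M) (α : Form E M d) (z : H) (w : Fin d → H) :
    pullbackToModel Φ α z w = formAt α (Φ z) fun i => differential E H Φ z (w i) := rfl

/-- Near `z` the map `Φ` factors through the chart at `Φ z`. Its pullback is therefore that of the
chart expression along a map of normed spaces, where ordinary calculus applies. -/
theorem pullbackToModel_eventuallyEq {d : ℕ} {Φ : H → M} {z : H}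
    (hΦ : ContMDiffAt 𝓘(ℝ, H) 𝓘(ℝ, E) ∞ Φ z) (α : Form E M d) :
    pullbackToModel Φ α =ᶠ[nhds z] fun z' =>
      (inChart α (Φ z) (extChartAt 𝓘(ℝ, E) (Φ z) (Φ z'))).compContinuousLinearMap
        (fderiv ℝ (fun z' => extChartAt 𝓘(ℝ, E) (Φ z) (Φ z')) z') := by
  -- Being `C^∞` at a point spreads to a neighbourhood only for each finite order; order one is
  -- enough here.
  have h1 : ∀ᶠ z' in nhds z, ContMDiffAt 𝓘(ℝ, H) 𝓘(ℝ, E) 1 Φ z' :=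
    (contMDiffAt_iff_contMDiffAt_nhds (by simp)).1 (hΦ.of_le (by simp))
  have h2 := hΦ.continuousAt.preimage_mem_nhds (extChartAt_source_mem_nhds (I := 𝓘(ℝ, E)) (Φ z))
  filter_upwards [h1, h2] with z' hz' hs
  rw [← differential_eq_fderiv, differential_comp (F := E) z'
    ((contMDiffAt_extChartAt_of_mem _ hs).mdifferentiableAt (by simp))
    (hz'.mdifferentiableAt (by simp))]
  ext w
  have h3 := differential_extChartAt_symm_comp _ hs
  have h4 : ∀ u : E, differential E E (extChartAt 𝓘(ℝ, E) (Φ z)).symm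
      (extChartAt 𝓘(ℝ, E) (Φ z) (Φ z')) (differential E E (extChartAt 𝓘(ℝ, E) (Φ z)) (Φ z') u) = u :=
    fun u => DFunLike.congr_fun h3 u
  rw [inChart_eq_pullbackToModel]
  simp only [pullbackToModel_apply, ContinuousAlternatingMap.compContinuousLinearMap_apply,
    ContinuousLinearMap.coe_comp, Function.comp_def, h4]
  rw [(extChartAt 𝓘(ℝ, E) (Φ z)).left_inv hs]

theorem inChart_contDiffAt {d : ℕ} {α : Form E M d} (hα : IsSmoothForm α) {m : M} {y : E}
    (hy : y ∈ (extChartAt 𝓘(ℝ, E) m).target) : ContDiffAt ℝ ∞ (inChart α m) y :=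
  (hα m).contDiffAt ((isOpen_extChartAt_target m).mem_nhds hy)

theorem contDiffAt_extChartAt_comp {Φ : H → M} {z : H}
    (hΦ : ContMDiffAt 𝓘(ℝ, H) 𝓘(ℝ, E) ∞ Φ z) :
    ContDiffAt ℝ ∞ (fun z' => extChartAt 𝓘(ℝ, E) (Φ z) (Φ z')) z :=
  contMDiffAt_iff_contDiffAt.1 ((contMDiffAt_extChartAt (x := Φ z)).comp z hΦ)

theorem differentiableAt_pullbackToModel {d : ℕ} {Φ : H → M} {z : H}
    (hΦ : ContMDiffAt 𝓘(ℝ, H) 𝓘(ℝ, E) ∞ Φ z) {α : Form E M d} (hα : IsSmoothForm α) :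
    DifferentiableAt ℝ (pullbackToModel Φ α) z := by
  refine DifferentiableAt.congr_of_eventuallyEq ?_ (pullbackToModel_eventuallyEq hΦ α)
  have h := contDiffAt_extChartAt_comp hΦ
  refine DifferentiableAt.continuousAlternatingMapCompContinuousLinearMap ?_ ?_
  · exact DifferentiableAt.comp z ((inChart_contDiffAt hα (mem_extChartAt_target _)).differentiableAt
      (by simp)) (h.differentiableAt (by simp))
  · exact (h.fderiv_right (m := 1) (by norm_cast)).differentiableAt (by simp)

/-- The exterior derivative commutes with pullbacks to normed spaces. -/
theorem extDeriv_pullbackToModel {d : ℕ} {Φ : H → M} {z : H}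
    (hΦ : ContMDiffAt 𝓘(ℝ, H) 𝓘(ℝ, E) ∞ Φ z) {α : Form E M d} (hα : IsSmoothForm α) :
    extDeriv (pullbackToModel Φ α) z = pullbackToModel Φ (extD α) z := by
  have h := contDiffAt_extChartAt_comp hΦ
  rw [(pullbackToModel_eventuallyEq hΦ α).extDeriv_eq, extDeriv_pullback
    (f := fun z' => extChartAt 𝓘(ℝ, E) (Φ z) (Φ z'))
    ((inChart_contDiffAt hα (mem_extChartAt_target _)).differentiableAt (by simp)) h
    (by rw [minSmoothness_of_isRCLikeNormedField]; exact ENat.LEInfty.out),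
    ← differential_eq_fderiv, differential_comp (F := E) z
    ((contMDiffAt_extChartAt (n := ∞)).mdifferentiableAt (by simp))
    (hΦ.mdifferentiableAt (by simp))]
  rfl

/-- `extD` uses a different chart at each point. Naturality under the inverse of one fixed chart
shows that the result is independent of that choice. -/
theorem inChart_extD {d : ℕ} {α : Form E M d} (hα : IsSmoothForm α) (m : M) :
    Set.EqOn (inChart (extD α) m) (extDeriv (inChart α m)) (extChartAt 𝓘(ℝ, E) m).target :=
  fun _ hy => (extDeriv_pullbackToModel (contMDiffAt_extChartAt_symm m hy) hα).symm

theorem isSmoothForm_extD {d : ℕ} {α : Form E M d} (hα : IsSmoothForm α) :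
    IsSmoothForm (extD α) := by
  intro m
  refine ContDiffOn.congr (fun y hy => ?_) (inChart_extD hα m)
  have h : ContDiffAt ℝ ∞ (fderiv ℝ (inChart α m)) y :=
    (inChart_contDiffAt hα hy).fderiv_right (by norm_cast)
  exact ((ContinuousAlternatingMap.alternatizeUncurryFinCLM ℝ E ℝ).contDiff.contDiffAt.comp y
    h).contDiffWithinAt

theorem extD_extD {d : ℕ} {α : Form E M d} (hα : IsSmoothForm α) : extD (extD α) = 0 := by
  ext1 m
  have h : inChart (extD α) m =ᶠ[nhds (extChartAt 𝓘(ℝ, E) m m)] extDeriv (inChart α m) :=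
    (inChart_extD hα m).eventuallyEq_of_mem (extChartAt_target_mem_nhds m)
  have h0 : extDeriv (inChart (extD α) m) (extChartAt 𝓘(ℝ, E) m m) = 0 := by
    rw [h.extDeriv_eq]
    exact extDeriv_extDeriv_apply (inChart_contDiffAt hα (mem_extChartAt_target m))
      (by rw [minSmoothness_of_isRCLikeNormedField]; exact ENat.LEInfty.out)
  rw [extD, h0]
  rfl

theorem extD_smul {d : ℕ} (c : ℝ) (α : Form E M d) : extD (c • α) = c • extD α := by
  ext1 m
  have h : inChart (c • α) m = c • inChart α m := rfl
  rw [extD, h, extDeriv_smul]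
  rfl

/-- At the centre of its own chart, `extD` is the transported `extDeriv`, and the differential of
the chart is invertible. No smoothness of `α` enters, so the lemma applies to `ι_{v_x} η` directly.
-/
theorem extDeriv_inChart_eq_zero {d : ℕ} {α : Form E M d} (hα : extD α = 0) (m : M) :
    extDeriv (inChart α m) (extChartAt 𝓘(ℝ, E) m m) = 0 := by
  have h1 := differential_extChartAt_comp_symm m (mem_extChartAt_target (I := 𝓘(ℝ, E)) m)
  rw [extChartAt_to_inv] at h1
  have h2 : (extDeriv (inChart α m) (extChartAt 𝓘(ℝ, E) m m)).compContinuousLinearMap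
    (differential E E (extChartAt 𝓘(ℝ, E) m) m) = 0 := congrFun hα m
  ext w
  have h3 := DFunLike.congr_fun h2 fun i =>
    differential E E (extChartAt 𝓘(ℝ, E) m).symm (extChartAt 𝓘(ℝ, E) m m) (w i)
  have h4 : ∀ u, differential E E (extChartAt 𝓘(ℝ, E) m) m
    (differential E E (extChartAt 𝓘(ℝ, E) m).symm (extChartAt 𝓘(ℝ, E) m m) u) = u :=
    fun u => DFunLike.congr_fun h1 u
  simp only [ContinuousAlternatingMap.compContinuousLinearMap_apply, Function.comp_def, h4] at h3
  exact h3

end Differential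

/-! ### Closed forms on a product and their restrictions to slices. -/

section Slice

variable {E : Type*} [NormedAddCommGroup E] [NormedSpace ℝ E]
  {F : Type*} [NormedAddCommGroup F] [NormedSpace ℝ F]

/-- Let `Ω` be a form on `E × F` that is closed at `(y, h)`. If the contraction of `Ω` with the
vector `(0, x)` restricts to a form on `E × {h}` that is closed at `y`, then the derivative
in the direction of `x` of the restrictions of `Ω` to the slices `E × {h'}` vanishes at `(y, h)`. -/
theorem fderiv_slice_eq_zero {d : ℕ} {Ω : E × F → (E × F) [⋀^Fin (d + 1)]→L[ℝ] ℝ} {y : E} {h x : F}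
    (hΩ : DifferentiableAt ℝ Ω (y, h)) (hΩ0 : extDeriv Ω (y, h) = 0)
    {β : E → E [⋀^Fin d]→L[ℝ] ℝ} (hβ0 : extDeriv β y = 0)
    (hβΩ : ∀ᶠ y' in nhds y, ∀ w,
      β y' w = Ω (y', h) (Matrix.vecCons (0, x) fun i => (w i, 0)))
    (w : Fin (d + 1) → E) :
    fderiv ℝ (fun h' => Ω (y, h') fun i => (w i, 0)) h x = 0 := by
  have hβ : DifferentiableAt ℝ β y := by
    have h1 : DifferentiableAt ℝ (fun y' => Ω (y', h)) y :=
      hΩ.comp y (hasFDerivAt_prodMk_left (𝕜 := ℝ) y h).differentiableAt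
    -- `C` contracts with `(0, x)` and restricts to `E`. Near `y`, `β` is the image under `C` of a
    -- slice of `Ω`, hence differentiable at `y`.
    let C : ((E × F) [⋀^Fin (d + 1)]→L[ℝ] ℝ) →L[ℝ] E [⋀^Fin d]→L[ℝ] ℝ :=
      (ContinuousAlternatingMap.compContinuousLinearMapCLM (ContinuousLinearMap.inl ℝ E F)).comp
        ((ContinuousLinearMap.apply ℝ ((E × F) [⋀^Fin d]→L[ℝ] ℝ) ((0, x) : E × F)).comp
          ContinuousAlternatingMap.curryLeftLI.toContinuousLinearMap)
    have h2 : DifferentiableAt ℝ (fun y' => C (Ω (y', h))) y := C.differentiableAt.comp y h1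
    refine h2.congr_of_eventuallyEq ?_
    filter_upwards [hβΩ] with y' hy'
    ext w
    exact hy' w
  have hc : ∀ u : Fin (d + 1) → E × F, DifferentiableAt ℝ (fun z => Ω z u) (y, h) := fun u =>
    (ContinuousAlternatingMap.apply ℝ (E × F) ℝ u).differentiableAt.comp (y, h) hΩ
  -- Evaluate `dΩ = 0` on `(0, x), (w₀, 0), …, (w_d, 0)`: the zeroth term is the derivative sought,
  -- and the others, with signs shifted by one, sum to `-dβ(w) = 0`.
  have h1 := DFunLike.congr_fun hΩ0 (Matrix.vecCons ((0, x) : E × F) fun i => (w i, 0))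
  have h2 := DFunLike.congr_fun hβ0 w
  rw [extDeriv_apply hΩ, Fin.sum_univ_succ] at h1
  rw [extDeriv_apply hβ] at h2
  have hin : ∀ (u : Fin (d + 1) → E × F) (v : E), fderiv ℝ (fun y' => Ω (y', h) u) y v =
      fderiv ℝ (fun z => Ω z u) (y, h) (v, 0) := by
    intro u v
    have := (hc u).hasFDerivAt.comp y (hasFDerivAt_prodMk_left (𝕜 := ℝ) y h)
    rw [HasFDerivAt.fderiv (f := fun y' => Ω (y', h) u) this]
    simp
  have hin' : ∀ (u : Fin (d + 1) → E × F) (v : F), fderiv ℝ (fun h' => Ω (y, h') u) h v =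
      fderiv ℝ (fun z => Ω z u) (y, h) (0, v) := by
    intro u v
    have := (hc u).hasFDerivAt.comp h (hasFDerivAt_prodMk_right (𝕜 := ℝ) y h)
    rw [HasFDerivAt.fderiv (f := fun h' => Ω (y, h') u) this]
    simp
  have h3 : ∀ i : Fin (d + 1), fderiv ℝ (fun z => Ω z (i.succ.removeNth
      (Matrix.vecCons ((0, x) : E × F) fun i => (w i, 0)))) (y, h) (w i, 0) =
        fderiv ℝ (fun y' => β y' (i.removeNth w)) y (w i) := by
    intro i
    have h4 : (fun y' => β y' (i.removeNth w)) =ᶠ[nhds y] fun y' =>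
        Ω (y', h) (Matrix.vecCons (0, x) fun j => (i.removeNth w j, 0)) := by
      filter_upwards [hβΩ] with y' hy' using hy' _
    rw [h4.fderiv_eq, hin]
    congr 2
    ext1 z
    congr 1
    ext1 j
    refine Fin.cases ?_ (fun j => ?_) j <;> simp [Fin.removeNth]
  rw [hin']
  simp only [Matrix.cons_val_succ, h3, Fin.val_succ, pow_succ, mul_neg_one, neg_smul,
    Finset.sum_neg_distrib, h2] at h1
  simpa [Fin.removeNth_zero, Fin.tail_def] using h1

end Slice

/-! ### The group action and invariance under connected sets of group elements. -/

section Action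

variable {F : Type*} [NormedAddCommGroup F] [NormedSpace ℝ F] [CompleteSpace F]
  {G : Type*} [TopologicalSpace G] [ChartedSpace F G] [Group G] [LieGroup 𝓘(ℝ, F) ∞ G]
  {E : Type*} [NormedAddCommGroup E] [NormedSpace ℝ E]
  {M : Type*} [TopologicalSpace M] [ChartedSpace E M] [IsManifold 𝓘(ℝ, E) ∞ M]
  (ϑ : SmoothRightAction F G E M)

theorem contMDiff_orbit (m : M) : ContMDiff 𝓘(ℝ, F) 𝓘(ℝ, E) ∞ (fun g : G => ϑ.act m g) :=
  ϑ.smooth.comp (contMDiff_const.prodMk contMDiff_id)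

theorem contMDiff_translation (g : G) : ContMDiff 𝓘(ℝ, E) 𝓘(ℝ, E) ∞ (fun m : M => ϑ.act m g) :=
  ϑ.smooth.comp (contMDiff_id.prodMk contMDiff_const)

theorem infinitesimal_eq_differential (m : M) (x : GroupLieAlgebra 𝓘(ℝ, F) G) :
    ϑ.infinitesimal m x = differential E F (fun g : G => ϑ.act m g) 1 x := rfl

/-- The infinitesimal action intertwines translations with the adjoint action. -/
theorem infinitesimal_act (m : M) (g : G) (x : GroupLieAlgebra 𝓘(ℝ, F) G) :
    (ϑ.infinitesimal (ϑ.act m g) x : E) =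
      differential E E (fun m => ϑ.act m g) m (ϑ.infinitesimal m (Ad F g x)) := by
  have h : (fun h : G => ϑ.act (ϑ.act m g) h) = fun h => ϑ.act (ϑ.act m (g * h * g⁻¹)) g := by
    ext h
    rw [← ϑ.act_mul, ← ϑ.act_mul]
    simp
  have h1 := differential_comp (E := E) (F := E) (H := F) (φ := fun m => ϑ.act m g)
    (ψ := fun h : G => ϑ.act m (g * h * g⁻¹)) 1
    ((contMDiff_translation ϑ g).mdifferentiable (by simp) _)
    (((contMDiff_orbit ϑ m).comp (contMDiff_conj g)).mdifferentiable (by simp) _)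
  have h2 := differential_comp (E := E) (F := F) (H := F) (φ := fun h : G => ϑ.act m h)
    (ψ := fun h : G => g * h * g⁻¹) 1
    ((contMDiff_orbit ϑ m).mdifferentiable (by simp) _) (mdifferentiableAt_conj g 1)
  have e : g * 1 * g⁻¹ = 1 := by simp
  rw [h2, e, ϑ.act_one, ← h] at h1
  exact DFunLike.congr_fun h1 x

/-- Translations pull back the contraction with `v_p` to the contraction with `v_{Ad_g p}`. -/
theorem pullback_contract_multiField {N k e : ℕ} (h : k + e = N) (g : G) (α : Form E M N)
    (p : ⋀[ℝ]^k (GroupLieAlgebra 𝓘(ℝ, F) G)) :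
    pullback (fun m => ϑ.act m g) (contract h (multiField ϑ.infinitesimal p) α) =
      contract h (multiField ϑ.infinitesimal (exteriorPower.map k (Ad F g) p))
        (pullback (fun m => ϑ.act m g) α) := by
  ext1 m
  have hA : ϑ.infinitesimal (ϑ.act m g) =
      (mfderiv 𝓘(ℝ, E) 𝓘(ℝ, E) (fun m => ϑ.act m g) m).toLinearMap ∘ₗ
        (ϑ.infinitesimal m ∘ₗ Ad F g) :=
    LinearMap.ext fun x => infinitesimal_act ϑ m g x
  have hm : multiField ϑ.infinitesimal p (ϑ.act m g) =
      exteriorPower.map k (mfderiv 𝓘(ℝ, E) 𝓘(ℝ, E) (fun m => ϑ.act m g) m).toLinearMap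
        (multiField ϑ.infinitesimal (exteriorPower.map k (Ad F g) p) m) := by
    unfold multiField
    rw [hA, exteriorPower.map_comp, exteriorPower.map_comp]
    rfl
  unfold pullback contract
  rw [contractMulti_compContinuousLinearMap, ← hm]

/-- The function `g ↦ (ϑ_g^* α)_m(w)`. -/
def pullbackEval {d : ℕ} (α : Form E M d) (m : M) (w : Fin d → E) (g : G) : ℝ :=
  formAt α (ϑ.act m g) fun i => differential E E (fun m => ϑ.act m g) m (w i)

theorem pullbackEval_one {d : ℕ} (α : Form E M d) (m : M) (w : Fin d → E) :
    pullbackEval ϑ α m w 1 = formAt α m w := by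
  have h : (fun m => ϑ.act m 1) = fun m : M => m := funext ϑ.act_one
  rw [pullbackEval, h, differential_id, ϑ.act_one]
  rfl

/-- This is `ϑ_{gl}^* = ϑ_g^* ϑ_l^*`; it carries statements at `1 ∈ G` to any `g`, at the price of
moving the base point and the vectors. -/
theorem pullbackEval_mul {d : ℕ} (α : Form E M d) (m : M) (w : Fin d → E) (g l : G) :
    pullbackEval ϑ α m w (g * l) = pullbackEval ϑ α (ϑ.act m g)
      (fun i => differential E E (fun m => ϑ.act m g) m (w i)) l := by
  have h : (fun m => ϑ.act m (g * l)) = fun m => ϑ.act (ϑ.act m g) l :=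
    funext fun m => ϑ.act_mul m g l
  have h1 := differential_comp (E := E) (F := E) (H := E) (φ := fun m => ϑ.act m l)
    (ψ := fun m => ϑ.act m g) m ((contMDiff_translation ϑ l).mdifferentiable (by simp) _)
    ((contMDiff_translation ϑ g).mdifferentiable (by simp) _)
  rw [pullbackEval, pullbackEval, h, h1, ϑ.act_mul]
  rfl

/-- The action near `(m, 1)`, in the charts of `M` at `m` and of `G` at `1`. -/
def actInCharts (m : M) (z : E × F) : M :=
  ϑ.act ((extChartAt 𝓘(ℝ, E) m).symm z.1) ((extChartAt 𝓘(ℝ, F) (1 : G)).symm z.2)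

theorem contMDiffAt_actInCharts (m : M) {z : E × F} (h1 : z.1 ∈ (extChartAt 𝓘(ℝ, E) m).target)
    (h2 : z.2 ∈ (extChartAt 𝓘(ℝ, F) (1 : G)).target) :
    ContMDiffAt 𝓘(ℝ, E × F) 𝓘(ℝ, E) ∞ (actInCharts ϑ m) z := by
  have hfst : ContMDiff 𝓘(ℝ, E × F) 𝓘(ℝ, E) ∞ (Prod.fst : E × F → E) := contDiff_fst.contMDiff
  have hsnd : ContMDiff 𝓘(ℝ, E × F) 𝓘(ℝ, F) ∞ (Prod.snd : E × F → F) := contDiff_snd.contMDiff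
  refine ContMDiffAt.comp (I' := 𝓘(ℝ, E).prod 𝓘(ℝ, F)) z ϑ.smooth.contMDiffAt
    (f := fun z : E × F => ((extChartAt 𝓘(ℝ, E) m).symm z.1,
      (extChartAt 𝓘(ℝ, F) (1 : G)).symm z.2)) (ContMDiffAt.prodMk ?_ ?_)
  · exact ContMDiffAt.comp (I' := 𝓘(ℝ, E)) z (contMDiffAt_extChartAt_symm m h1) hfst.contMDiffAt
  · exact ContMDiffAt.comp (I' := 𝓘(ℝ, F)) z (contMDiffAt_extChartAt_symm (1 : G) h2) hsnd.contMDiffAt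

/-- One of the two partial differentials of the action: along `M` it is the differential of a
translation, whereas along `G`, at `1`, it is the infinitesimal action. -/
theorem differential_actInCharts_left (m : M) {y : E} {g : G}
    (hy : y ∈ (extChartAt 𝓘(ℝ, E) m).target) (hg : g ∈ (extChartAt 𝓘(ℝ, F) (1 : G)).source)
    (w : E) :
    differential E (E × F) (actInCharts ϑ m) (y, extChartAt 𝓘(ℝ, F) (1 : G) g) (w, 0) =
      differential E E (fun m => ϑ.act m g) ((extChartAt 𝓘(ℝ, E) m).symm y)
        (differential E E (extChartAt 𝓘(ℝ, E) m).symm y w) := by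
  have hg' := (extChartAt 𝓘(ℝ, F) (1 : G)).map_source hg
  have h1 := differential_comp (E := E) (F := E × F) (H := E) (φ := actInCharts ϑ m)
    (ψ := fun y => (y, extChartAt 𝓘(ℝ, F) (1 : G) g)) y
    ((contMDiffAt_actInCharts ϑ m (z := (y, _)) hy hg').mdifferentiableAt (by simp))
    (hasFDerivAt_prodMk_left y _).differentiableAt.mdifferentiableAt
  have h2 := differential_comp (E := E) (F := E) (H := E) (φ := fun m => ϑ.act m g)
    (ψ := (extChartAt 𝓘(ℝ, E) m).symm) y ((contMDiff_translation ϑ g).mdifferentiable (by simp) _)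
    ((contMDiffAt_extChartAt_symm m hy).mdifferentiableAt (by simp))
  have h3 : (fun y => actInCharts ϑ m (y, extChartAt 𝓘(ℝ, F) (1 : G) g)) =
      fun y => ϑ.act ((extChartAt 𝓘(ℝ, E) m).symm y) g := by
    ext y
    rw [actInCharts, (extChartAt 𝓘(ℝ, F) (1 : G)).left_inv hg]
  rw [h3, h2, differential_eq_fderiv (fun y => (y, extChartAt 𝓘(ℝ, F) (1 : G) g)),
    (hasFDerivAt_prodMk_left y _).fderiv] at h1
  exact (DFunLike.congr_fun h1 w).symm

theorem differential_actInCharts_right (m : M) {y : E} (hy : y ∈ (extChartAt 𝓘(ℝ, E) m).target)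
    (x : F) :
    differential E (E × F) (actInCharts ϑ m) (y, extChartAt 𝓘(ℝ, F) (1 : G) 1)
        (0, differential F F (extChartAt 𝓘(ℝ, F) (1 : G)) 1 x) =
      differential E F (fun g : G => ϑ.act ((extChartAt 𝓘(ℝ, E) m).symm y) g) 1 x := by
  have h0 := mem_extChartAt_source (I := 𝓘(ℝ, F)) (1 : G)
  have h0' := mem_extChartAt_target (I := 𝓘(ℝ, F)) (1 : G)
  have hΦ := (contMDiffAt_actInCharts ϑ m (z := (y, _)) hy h0').mdifferentiableAt
    (n := ∞) (by simp)
  have hr : MDifferentiableAt 𝓘(ℝ, F) 𝓘(ℝ, E × F) (fun h : F => (y, h))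
      (extChartAt 𝓘(ℝ, F) (1 : G) 1) :=
    (hasFDerivAt_prodMk_right y _).differentiableAt.mdifferentiableAt
  have h1 := differential_comp (E := E) (F := E × F) (H := F) (φ := actInCharts ϑ m)
    (ψ := fun h => (y, h)) (extChartAt 𝓘(ℝ, F) (1 : G) 1) hΦ hr
  have h2 := differential_comp (E := E) (F := F) (H := F) (φ := fun h => actInCharts ϑ m (y, h))
    (ψ := extChartAt 𝓘(ℝ, F) (1 : G)) 1 (hΦ.comp _ hr)
    ((contMDiffAt_extChartAt (n := ∞)).mdifferentiableAt (by simp))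
  have h3 : (fun g => actInCharts ϑ m (y, extChartAt 𝓘(ℝ, F) (1 : G) g)) =ᶠ[nhds 1]
      fun g => ϑ.act ((extChartAt 𝓘(ℝ, E) m).symm y) g := by
    filter_upwards [(isOpen_extChartAt_source (I := 𝓘(ℝ, F)) (1 : G)).mem_nhds h0] with g hg
    rw [actInCharts, (extChartAt 𝓘(ℝ, F) (1 : G)).left_inv hg]
  rw [differential_congr h3, h1, differential_eq_fderiv (fun h : F => (y, h)),
    (hasFDerivAt_prodMk_right y _).fderiv] at h2
  exact (DFunLike.congr_fun h2 x).symm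

theorem formAt_interior {d : ℕ} (X : VField E M) (α : Form E M (d + 1)) (m : M) (w : Fin d → E) :
    formAt (interior (Nat.add_comm 1 d) X α) m w =
      formAt α m (Matrix.vecCons (X m : E) w) := by
  refine (contractMulti_ιMulti (Nat.add_comm 1 d) (α m) (fun _ => X m) w).trans ?_
  change α m _ = α m _
  congr 1
  ext i
  refine Fin.cases ?_ (fun i => ?_) i
  · have : Fin.cast (Nat.add_comm 1 d).symm (0 : Fin (d + 1)) = Fin.castAdd d 0 := by ext; simp
    rw [Function.comp_apply, this]
    exact Fin.append_left _ w 0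
  · have : Fin.cast (Nat.add_comm 1 d).symm i.succ = Fin.natAdd 1 i := by
      ext; simp [Nat.add_comm]
    rw [Function.comp_apply, this]
    exact Fin.append_right _ w i

/-- The slice over `g` of the pulled-back form is `ϑ_g^* α`, so differentiating across slices
differentiates `ϑ_g^* α` in `g`. -/
theorem pullbackToModel_actInCharts_left {d : ℕ} (α : Form E M d) (m : M) {y : E} {g : G}
    (hy : y ∈ (extChartAt 𝓘(ℝ, E) m).target) (hg : g ∈ (extChartAt 𝓘(ℝ, F) (1 : G)).source)
    (w : Fin d → E) :
    pullbackToModel (actInCharts ϑ m) α (y, extChartAt 𝓘(ℝ, F) (1 : G) g) (fun i => (w i, 0)) =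
      pullbackEval ϑ α ((extChartAt 𝓘(ℝ, E) m).symm y)
        (fun i => differential E E (extChartAt 𝓘(ℝ, E) m).symm y (w i)) g := by
  rw [pullbackToModel_apply, pullbackEval]
  simp only [differential_actInCharts_left ϑ m hy hg]
  rw [actInCharts, (extChartAt 𝓘(ℝ, F) (1 : G)).left_inv hg]

/-- Supplies the `β` of `fderiv_slice_eq_zero`. Over `1` the group direction is sent to `v_x`, and
the directions along `M` are only transported by the chart since `ϑ_1` is the identity. -/
theorem pullbackToModel_actInCharts_vecCons {d : ℕ} (α : Form E M (d + 1)) (m : M) {y : E}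
    (hy : y ∈ (extChartAt 𝓘(ℝ, E) m).target) (x : GroupLieAlgebra 𝓘(ℝ, F) G) (w : Fin d → E) :
    pullbackToModel (actInCharts ϑ m) α (y, extChartAt 𝓘(ℝ, F) (1 : G) 1)
        (Matrix.vecCons (0, differential F F (extChartAt 𝓘(ℝ, F) (1 : G)) 1 x)
          fun i => (w i, 0)) =
      inChart (interior (Nat.add_comm 1 d) (fun m => ϑ.infinitesimal m x) α) m y w := by
  rw [inChart_eq_pullbackToModel, pullbackToModel_apply, pullbackToModel_apply, formAt_interior,
    infinitesimal_eq_differential]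
  have h1 : actInCharts ϑ m (y, extChartAt 𝓘(ℝ, F) (1 : G) 1) =
      (extChartAt 𝓘(ℝ, E) m).symm y := by
    rw [actInCharts, extChartAt_to_inv, ϑ.act_one]
  rw [h1]
  congr 1
  ext i
  refine Fin.cases ?_ (fun i => ?_) i
  · exact differential_actInCharts_right ϑ m hy x
  · have h2 : (fun m => ϑ.act m 1) = fun m : M => m := funext ϑ.act_one
    refine (differential_actInCharts_left ϑ m hy (mem_extChartAt_source (1 : G)) (w i)).trans ?_
    rw [h2, differential_id]
    rfl

variable {n : ℕ} {η : Form E M (n + 1)}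

/-- The functions `g ↦ (ϑ_g^* η)_m(w)` have vanishing differential at `1`, if `η` is closed and its
contractions with the fields `v_x` are closed. -/
theorem pullbackEval_hasDifferential_one (hη : IsPrePlectic n η)
    (hx : ∀ x, extD (interior (Nat.add_comm 1 n) (fun m => ϑ.infinitesimal m x) η) = 0)
    (m : M) (w : Fin (n + 1) → E) :
    MDifferentiableAt 𝓘(ℝ, F) 𝓘(ℝ, ℝ) (pullbackEval ϑ η m w) 1 ∧
      differential ℝ F (pullbackEval ϑ η m w) 1 = 0 := by
  have hm := mem_extChartAt_source (I := 𝓘(ℝ, E)) m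
  have hm' := mem_extChartAt_target (I := 𝓘(ℝ, E)) m
  have h0 := mem_extChartAt_source (I := 𝓘(ℝ, F)) (1 : G)
  have h0' := mem_extChartAt_target (I := 𝓘(ℝ, F)) (1 : G)
  set y := extChartAt 𝓘(ℝ, E) m m with hy
  set χ := extChartAt 𝓘(ℝ, F) (1 : G) with hχ
  set Ω := pullbackToModel (actInCharts ϑ m) η with hΩ
  -- The coordinates of the `w i` in the chart at `m`, so that the inverse chart returns the `w i`.
  set w' : Fin (n + 1) → E := fun i => differential E E (extChartAt 𝓘(ℝ, E) m) m (w i) with hw'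
  have hΦ := contMDiffAt_actInCharts ϑ m (z := (y, χ 1)) hm' h0'
  have hΩd : DifferentiableAt ℝ Ω (y, χ 1) := differentiableAt_pullbackToModel hΦ hη.smooth
  have hΩ0 : extDeriv Ω (y, χ 1) = 0 := by
    rw [hΩ, extDeriv_pullbackToModel hΦ hη.smooth, hη.closed]
    rfl
  have hw : ∀ i, differential E E (extChartAt 𝓘(ℝ, E) m).symm y (w' i) = w i := fun i =>
    DFunLike.congr_fun (differential_extChartAt_symm_comp m hm) (w i)
  have hu : pullbackEval ϑ η m w =ᶠ[nhds 1] fun g => Ω (y, χ g) fun i => (w' i, 0) := by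
    filter_upwards [(isOpen_extChartAt_source (I := 𝓘(ℝ, F)) (1 : G)).mem_nhds h0] with g hg
    rw [hΩ, pullbackToModel_actInCharts_left ϑ η m hm' hg]
    simp only [hw]
    rw [hy, extChartAt_to_inv]
  have hs : DifferentiableAt ℝ (fun h => Ω (y, h) fun i => (w' i, 0)) (χ 1) :=
    ((ContinuousAlternatingMap.apply ℝ (E × F) ℝ _).differentiableAt.comp _ hΩd).comp (χ 1)
      (hasFDerivAt_prodMk_right y _).differentiableAt
  have hχd : MDifferentiableAt 𝓘(ℝ, F) 𝓘(ℝ, F) χ 1 :=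
    (contMDiffAt_extChartAt (n := ∞)).mdifferentiableAt (by simp)
  refine ⟨(hs.mdifferentiableAt.comp 1 hχd).congr_of_eventuallyEq hu, ?_⟩
  rw [differential_congr hu, differential_comp (F := F) (φ := fun h => Ω (y, h) fun i => (w' i, 0))
    1 hs.mdifferentiableAt hχd, differential_eq_fderiv]
  ext x
  have hev : ∀ᶠ y' in nhds y, y' ∈ (extChartAt 𝓘(ℝ, E) m).target :=
    (isOpen_extChartAt_target m).mem_nhds hm'
  -- The direction in `F` is the coordinate vector of `x`, and `β` is the chart expression of
  -- `ι_{v_x} η`, closed at `y` by `hx`.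
  refine fderiv_slice_eq_zero hΩd hΩ0 (extDeriv_inChart_eq_zero (hx x) m) ?_ w'
  filter_upwards [hev] with y' hy' u
  exact (pullbackToModel_actInCharts_vecCons ϑ η m hy' x u).symm

/-- Left translation by `g⁻¹` reduces the differential at `g` to the one at `1` for the base point
`m·g`, so it vanishes on all of `G`. -/
theorem pullbackEval_isLocallyConstant (hη : IsPrePlectic n η)
    (hx : ∀ x, extD (interior (Nat.add_comm 1 n) (fun m => ϑ.infinitesimal m x) η) = 0)
    (m : M) (w : Fin (n + 1) → E) : IsLocallyConstant (pullbackEval ϑ η m w) := by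
  have h : ∀ g, MDifferentiableAt 𝓘(ℝ, F) 𝓘(ℝ, ℝ) (pullbackEval ϑ η m w) g ∧
      differential ℝ F (pullbackEval ϑ η m w) g = 0 := by
    intro g
    set u := pullbackEval ϑ η (ϑ.act m g)
      (fun i => differential E E (fun m => ϑ.act m g) m (w i)) with hu
    have e : pullbackEval ϑ η m w = fun l => u (g⁻¹ * l) := by
      ext l
      rw [hu, ← pullbackEval_mul, mul_inv_cancel_left]
    have e1 : g⁻¹ * g = 1 := inv_mul_cancel g
    obtain ⟨h1, h2⟩ := pullbackEval_hasDifferential_one ϑ hη hx (ϑ.act m g)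
      (fun i => differential E E (fun m => ϑ.act m g) m (w i))
    rw [← hu, ← e1] at h1 h2
    rw [e]
    refine ⟨h1.comp g (mdifferentiableAt_mulLeft g⁻¹ g), ?_⟩
    rw [differential_comp (F := F) g h1 (mdifferentiableAt_mulLeft g⁻¹ g), h2,
      ContinuousLinearMap.zero_comp]
  exact isLocallyConstant_of_differential_eq_zero (fun g => (h g).1) fun g => (h g).2

/-- A closed form whose contractions with the fields `v_x` are closed is invariant under every
element of a connected subset of `G` that contains the identity. -/
theorem pullback_eq_of_isPreconnected (hη : IsPrePlectic n η)
    (hx : ∀ x, extD (interior (Nat.add_comm 1 n) (fun m => ϑ.infinitesimal m x) η) = 0)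
    {s : Set G} (hs : IsPreconnected s) (h1 : (1 : G) ∈ s) {g : G} (hg : g ∈ s) :
    pullback (fun m => ϑ.act m g) η = η := by
  ext m w
  exact ((pullbackEval_isLocallyConstant ϑ hη hx m w).apply_eq_of_isPreconnected hs hg h1).trans
    (pullbackEval_one ϑ η m w)

/-- Connectedness is all that invariance needs from `G_p^0`; the component, taken in the subspace
topology, has a connected image in `G`. -/
theorem exists_isPreconnected_of_mem_isotropyComponent {k : ℕ}
    (p : ⋀[ℝ]^k (GroupLieAlgebra 𝓘(ℝ, F) G)) {g : G} (hg : g ∈ isotropyComponent p) :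
    ∃ s : Set G, IsPreconnected s ∧ 1 ∈ s ∧ g ∈ s := by
  obtain ⟨g, hg, rfl⟩ := hg
  exact ⟨(Subtype.val : isotropyGroup p → G) '' connectedComponent 1,
    isPreconnected_connectedComponent.image _ continuous_subtype_val.continuousOn,
    ⟨1, mem_connectedComponent, rfl⟩, ⟨g, hg, rfl⟩⟩

/-- If `η` is closed and has closed contractions with the fields `v_x`, then `ι(v_p) η` is invariant
under the identity component of the isotropy group of `p`. -/
theorem pullback_contract_multiField_of_mem_isotropyComponent (hη : IsPrePlectic n η)
    (hx : ∀ x, extD (interior (Nat.add_comm 1 n) (fun m => ϑ.infinitesimal m x) η) = 0)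
    {k e : ℕ} (h : k + e = n + 1) (p : ⋀[ℝ]^k (GroupLieAlgebra 𝓘(ℝ, F) G)) {g : G}
    (hg : g ∈ isotropyComponent p) :
    pullback (fun m => ϑ.act m g) (contract h (multiField ϑ.infinitesimal p) η) =
      contract h (multiField ϑ.infinitesimal p) η := by
  obtain ⟨s, hs, h1, hgs⟩ := exists_isPreconnected_of_mem_isotropyComponent p hg
  have hp : exteriorPower.map k (Ad F g) p = p := isotropyComponent_le p hg
  rw [pullback_contract_multiField, hp, pullback_eq_of_isPreconnected ϑ hη hx hs h1 hgs]

end Action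

/-! ### The form `ι(v_p) η` and the relations for the induced components. -/

section CoMomentum

variable {E : Type*} [NormedAddCommGroup E] [NormedSpace ℝ E]
  {M : Type*} [TopologicalSpace M] [ChartedSpace E M] [IsManifold 𝓘(ℝ, E) ∞ M]
  {L : Type*} [LieRing L] [LieAlgebra ℝ L]
  {v : ∀ m : M, L →ₗ[ℝ] TangentSpace 𝓘(ℝ, E) m}

theorem extD_zero {d : ℕ} : extD (0 : Form E M d) = 0 := by
  have h := extD_smul (0 : ℝ) (0 : Form E M d)
  rwa [zero_smul, zero_smul] at h

theorem interior_zero {N e : ℕ} (h : 1 + e = N) (X : VField E M) :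
    interior h X (0 : Form E M N) = 0 := by
  ext m w
  exact contractMulti_ιMulti h _ _ _

theorem form_neg_smul {d : ℕ} (c : ℝ) (α : Form E M d) : -c • α = -(c • α) := neg_smul c α

theorem form_smul_neg {d : ℕ} (c : ℝ) (α : Form E M d) : c • -α = -(c • α) := smul_neg c α

theorem multiField_ιMulti_one (x : L) :
    multiField v (exteriorPower.ιMulti ℝ 1 fun _ => x) =
      fun m => exteriorPower.ιMulti ℝ 1 fun _ => v m x := by
  ext1 m
  rw [multiField, exteriorPower.map_apply_ιMulti]
  rfl

theorem contract_multiField_ιMulti_one {N e : ℕ} (h : 1 + e = N) (x : L) (α : Form E M N) :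
    contract h (multiField v (exteriorPower.ιMulti ℝ 1 fun _ => x)) α =
      interior h (fun m => v m x) α := by
  rw [multiField_ιMulti_one]
  rfl

/-- Pointwise this is `contractMulti_contractMulti_swap`, combined with `v_{q ∧ p} = v_q ∧ v_p`. -/
theorem contract_restrictAction_contract {N N' j k e : ℕ} (h : k + N' = N) (h' : j + e = N')
    (h'' : j + k + e = N) (η : Form E M N) (S : LieSubalgebra ℝ L) (p : ⋀[ℝ]^k L) (q : ⋀[ℝ]^j S) :
    contract h' (multiField (restrictAction S v) q) (contract h (multiField v p) η) =
      (-1 : ℝ) ^ (j * k) • contract h''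
        (multiField v (wedgeRight j p (exteriorPower.map j S.toSubmodule.subtype q))) η := by
  ext1 m
  have hq : multiField (restrictAction S v) q m =
      exteriorPower.map j (v m) (exteriorPower.map j S.toSubmodule.subtype q) := by
    unfold multiField restrictAction
    rw [exteriorPower.map_comp]
    rfl
  have hpq : multiField v (wedgeRight j p (exteriorPower.map j S.toSubmodule.subtype q)) m =
      wedgeRight j (multiField v p m) (multiField (restrictAction S v) q m) := by
    rw [hq]
    exact map_wedgeRight _ _ _
  refine (contractMulti_contractMulti_swap h h' h'' (η m) (multiField v p m)
    (multiField (restrictAction S v) q m)).trans ?_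
  rw [← hpq]
  rfl

variable {n : ℕ} {η : Form E M (n + 1)} {f : Components E M L n}

/-- The degree `i + 1 + k` of `q ∧ p` is not literally a successor. Freeing the degrees and testing
the boundary in the exterior algebra makes the relation of `f` applicable there. -/
theorem IsLInftyMorphism.main_of_coe_eq_boundary (hf : IsLInftyMorphism v η f) {a b d : ℕ}
    (hab : a + 1 = b) (h : b + d = n) (q : ⋀[ℝ]^b L) (q' : ⋀[ℝ]^a L)
    (hq : (q' : ExteriorAlgebra ℝ L) = boundary (q : ExteriorAlgebra ℝ L)) :
    -(f a (d + 1) (by omega) q' : Form E M (d + 1)) =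
      extD (f b d h q : Form E M d) +
        varsigma b • contract (by omega) (multiField v q) η := by
  subst hab
  obtain rfl : q' = boundaryAt a q := Subtype.ext hq
  exact hf.main a d h q

theorem IsLInftyMorphism.top_of_coe_eq_boundary (hf : IsLInftyMorphism v η f) {a b : ℕ}
    (ha : a + 0 = n) (hb : b + 0 = n + 1) (q : ⋀[ℝ]^b L) (q' : ⋀[ℝ]^a L)
    (hq : (q' : ExteriorAlgebra ℝ L) = boundary (q : ExteriorAlgebra ℝ L)) :
    -(f a 0 ha q' : Form E M 0) = varsigma b • contract hb (multiField v q) η := by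
  obtain rfl : a = n := by omega
  obtain rfl : b = a + 1 := by omega
  obtain rfl : q' = boundaryAt a q := Subtype.ext hq
  exact hf.top q

/-- The form `ι(v_p) η` is exact if `p` is a cycle. -/
theorem IsLInftyMorphism.contract_eq_extD (hf : IsLInftyMorphism v η f) {k r : ℕ} (hk : 1 ≤ k)
    (hkr : k + r = n) (h : k + (r + 1) = n + 1) (p : ⋀[ℝ]^k L)
    (hp : boundary (p : ExteriorAlgebra ℝ L) = 0) :
    contract h (multiField v p) η = -varsigma k • extD (f k r hkr p : Form E M r) := by
  -- The relation in degree `k = (k - 1) + 1`; its left side is `f_{k-1}(0)` because `p` is a cycle.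
  have h1 := hf.main_of_coe_eq_boundary (Nat.sub_add_cancel hk) hkr p 0 hp.symm
  rw [map_zero, Submodule.coe_zero, neg_zero] at h1
  have h2 := congrArg (varsigma k • ·) h1
  simp only [smul_zero, smul_add, smul_smul, varsigma_mul_self, one_smul] at h2
  rw [form_neg_smul]
  exact eq_neg_of_add_eq_zero_right h2.symm

/-- Exactness yields smoothness as well as closedness, both inherited from the smooth form `f_k(p)`.
-/
theorem IsLInftyMorphism.isPrePlectic_contract (hf : IsLInftyMorphism v η f) {k r : ℕ} (hk : 1 ≤ k)
    (hkr : k + r = n) (h : k + (r + 1) = n + 1) (p : ⋀[ℝ]^k L)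
    (hp : boundary (p : ExteriorAlgebra ℝ L) = 0) :
    IsPrePlectic r (contract h (multiField v p) η) := by
  rw [hf.contract_eq_extD hk hkr h p hp]
  exact ⟨Submodule.smul_mem _ _ (isSmoothForm_extD (f k r hkr p).2),
    by rw [extD_smul, extD_extD (f k r hkr p).2, smul_zero]⟩

section Induced

variable {k r : ℕ} (hkr : k + r = n) (p : ⋀[ℝ]^k L)

theorem inducedComponents_succ_apply (j d : ℕ) (h : j + 1 + d = r)
    (q : ⋀[ℝ]^(j + 1) (isotropyAlgebra p)) :
    (inducedComponents hkr p f (j + 1) d h q : Form E M d) =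
      -varsigma k • (f (j + 1 + k) d (by omega) (wedgeRight (j + 1) p
        (exteriorPower.map (j + 1) (isotropyAlgebra p).toSubmodule.subtype q)) : Form E M d) := rfl

/-- The defining formula of `f^p` fails in degree `0`, where `f^p_0 = 0` but `f_k(p)` may be
nonzero. On boundaries it holds even there, since `∂` vanishes on `Λ¹`. -/
theorem inducedComponents_boundaryAt (i d : ℕ) (h : i + d = r)
    (q : ⋀[ℝ]^(i + 1) (isotropyAlgebra p)) :
    (inducedComponents hkr p f i d h (boundaryAt i q) : Form E M d) =
      -varsigma k • (f (i + k) d (by omega) (wedgeRight i p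
        (exteriorPower.map i (isotropyAlgebra p).toSubmodule.subtype (boundaryAt i q))) :
          Form E M d) := by
  cases i with
  | zero =>
    rw [boundaryAt_zero]
    simp only [LinearMap.zero_apply, map_zero, Submodule.coe_zero, smul_zero]
  | succ j => rfl

theorem coe_wedgeRight_map_boundaryAt
    (hp : boundary (p : ExteriorAlgebra ℝ L) = 0) (i : ℕ) (q : ⋀[ℝ]^(i + 1) (isotropyAlgebra p)) :
    (wedgeRight i p (exteriorPower.map i (isotropyAlgebra p).toSubmodule.subtype
      (boundaryAt i q)) : ExteriorAlgebra ℝ L) =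
    boundary (wedgeRight (i + 1) p (exteriorPower.map (i + 1)
      (isotropyAlgebra p).toSubmodule.subtype q) : ExteriorAlgebra ℝ L) := by
  rw [coe_wedgeRight, coe_wedgeRight, coe_exteriorPower_map, coe_exteriorPower_map,
    boundary_map_subtype_mul p hp, coe_boundaryAt]

theorem varsigma_mul_varsigma_add (j k : ℕ) :
    varsigma k * varsigma (j + k) = -(varsigma j * (-1) ^ (j * k)) := by
  rw [varsigma_add]
  linear_combination -(varsigma j * (-1) ^ (j * k)) * varsigma_mul_self k

/-- The relation of `f` at `q ∧ p`, scaled by `-ς(k)`; the resulting coefficient is `ς(i+1)` times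
exactly the sign of reordering `ι(v_q) ι(v_p)`. -/
theorem inducedComponents_main
    (hp : boundary (p : ExteriorAlgebra ℝ L) = 0) (hf : IsLInftyMorphism v η f) (hr : k + (r + 1) = n + 1) (i d : ℕ)
    (h : i + 1 + d = r) (q : ⋀[ℝ]^(i + 1) (isotropyAlgebra p)) :
    -(inducedComponents hkr p f i (d + 1) (by omega) (boundaryAt i q) : Form E M (d + 1)) =
      extD (inducedComponents hkr p f (i + 1) d h q : Form E M d) +
        varsigma (i + 1) • contract (by omega) (multiField (restrictAction (isotropyAlgebra p) v) q)
          (contract hr (multiField v p) η) := by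
  have h1 := hf.main_of_coe_eq_boundary (by omega) (by omega) _ _
    (coe_wedgeRight_map_boundaryAt p hp i q) (d := d)
  rw [inducedComponents_boundaryAt, inducedComponents_succ_apply, ← form_smul_neg, h1, extD_smul,
    contract_restrictAction_contract hr _ (by omega), smul_add, smul_smul, smul_smul, neg_mul,
    varsigma_mul_varsigma_add, neg_neg]

theorem inducedComponents_top
    (hp : boundary (p : ExteriorAlgebra ℝ L) = 0) (hf : IsLInftyMorphism v η f) (hr : k + (r + 1) = n + 1)
    (q : ⋀[ℝ]^(r + 1) (isotropyAlgebra p)) :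
    -(inducedComponents hkr p f r 0 rfl (boundaryAt r q) : Form E M 0) =
      varsigma (r + 1) • contract rfl (multiField (restrictAction (isotropyAlgebra p) v) q)
        (contract hr (multiField v p) η) := by
  have h1 := hf.top_of_coe_eq_boundary (by omega) (by omega) _ _
    (coe_wedgeRight_map_boundaryAt p hp r q)
  rw [inducedComponents_boundaryAt, ← form_smul_neg, h1,
    contract_restrictAction_contract hr _ (by omega), smul_smul, smul_smul, neg_mul,
    varsigma_mul_varsigma_add, neg_neg]

theorem inducedComponents_momentum
    (hp : boundary (p : ExteriorAlgebra ℝ L) = 0) (hf : IsLInftyMorphism v η f) (hr : k + (r + 1) = n + 1) (d : ℕ)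
    (h : 1 + d = r) (x : isotropyAlgebra p) :
    extD (inducedComponents hkr p f 1 d h (exteriorPower.ιMulti ℝ 1 fun _ => x) : Form E M d) =
      -interior (by omega) (fun m => restrictAction (isotropyAlgebra p) v m x)
        (contract hr (multiField v p) η) := by
  have h1 := inducedComponents_main hkr p hp hf hr 0 d h (exteriorPower.ιMulti ℝ 1 fun _ => x)
  rw [boundaryAt_zero, LinearMap.zero_apply, map_zero, Submodule.coe_zero, neg_zero,
    varsigma_one, one_smul] at h1
  rw [← contract_multiField_ιMulti_one]
  exact eq_neg_of_add_eq_zero_left h1.symm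

theorem extD_interior_contract (hkr : k + r = n) (p : ⋀[ℝ]^k L)
    (hp : boundary (p : ExteriorAlgebra ℝ L) = 0) (hf : IsLInftyMorphism v η f) (hr : k + (r + 1) = n + 1)
    (x : isotropyAlgebra p) :
    extD (interior (Nat.add_comm 1 r) (fun m => restrictAction (isotropyAlgebra p) v m x)
      (contract hr (multiField v p) η)) = 0 := by
  -- For `r = 0` there is no `f^p_1`, and the top relation makes the contraction itself zero; for `r
  -- > 0` it is `-d f^p_1(x)`, hence closed.
  rcases Nat.eq_zero_or_pos r with rfl | hpos
  · have h1 := inducedComponents_top hkr p hp hf hr (exteriorPower.ιMulti ℝ 1 fun _ => x)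
    rw [boundaryAt_zero, LinearMap.zero_apply, map_zero, Submodule.coe_zero, neg_zero,
      varsigma_one, one_smul] at h1
    rw [← contract_multiField_ιMulti_one, ← extD_zero]
    exact congrArg extD h1.symm
  · obtain ⟨d, rfl⟩ : ∃ d, r = d + 1 := ⟨r - 1, by omega⟩
    have h1 := inducedComponents_momentum hkr p hp hf hr d (Nat.add_comm 1 d) x
    rw [← neg_neg (interior _ _ _), ← h1, ← neg_one_smul ℝ, extD_smul,
      extD_extD (inducedComponents hkr p f 1 d _ _).2, smul_zero]

theorem isMultisymplecticAction_restrictAction (hkr : k + r = n) (p : ⋀[ℝ]^k L)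
    (hp : boundary (p : ExteriorAlgebra ℝ L) = 0) (hv : IsMultisymplecticAction v η)
    (hf : IsLInftyMorphism v η f) (hk : 1 ≤ k) (hr : k + (r + 1) = n + 1) :
    IsMultisymplecticAction (restrictAction (isotropyAlgebra p) v)
      (contract hr (multiField v p) η) where
  smooth x := hv.smooth x
  map_lie x y m := hv.map_lie x y m
  lieDerivative_eq_zero x := by
    rw [lieDerivative, extD_interior_contract hkr p hp hf hr,
      (hf.isPrePlectic_contract hk hkr hr p hp).closed, interior_zero, add_zero]

/-- The components `f^p` form a co-momentum map for the action of the isotropy algebra of the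
cycle `p` on `(M, ι(v_p) η)`. -/
theorem isCoMomentumMap_inducedComponents
    (hp : boundary (p : ExteriorAlgebra ℝ L) = 0) (hf : IsCoMomentumMap v η f) (hk : 1 ≤ k)
    (hr : k + (r + 1) = n + 1) :
    IsCoMomentumMap (restrictAction (isotropyAlgebra p) v) (contract hr (multiField v p) η)
      (inducedComponents hkr p f) where
  action := isMultisymplecticAction_restrictAction hkr p hp hf.action hf.morphism hk hr
  morphism :=
    { zero := fun _ _ => rfl
      hamiltonian := by
        intro d h q
        obtain ⟨x, rfl⟩ := exists_eq_ιMulti_one q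
        exact ⟨_, hf.action.smooth x, inducedComponents_momentum hkr p hp hf.morphism hr d h x⟩
      main := inducedComponents_main hkr p hp hf.morphism hr
      top := inducedComponents_top hkr p hp hf.morphism hr }
  momentum := inducedComponents_momentum hkr p hp hf.morphism hr

end Induced

end CoMomentum

/-! ### Equivariance of the induced components. -/

section Equivariance

variable {F : Type*} [NormedAddCommGroup F] [NormedSpace ℝ F] [CompleteSpace F]
  {G : Type*} [TopologicalSpace G] [ChartedSpace F G] [Group G] [LieGroup 𝓘(ℝ, F) ∞ G]
  {E : Type*} [NormedAddCommGroup E] [NormedSpace ℝ E]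
  {M : Type*} [TopologicalSpace M] [ChartedSpace E M] [IsManifold 𝓘(ℝ, E) ∞ M]

/-- Since `g` fixes `p`, `Ad_g (q ∧ p) = Ad_g q ∧ p`, and the inclusion of `𝔤_p` intertwines the two
adjoint actions. -/
theorem isEquivariant_inducedComponents {n k r : ℕ} (hkr : k + r = n)
    {f : Components E M (GroupLieAlgebra 𝓘(ℝ, F) G) n} {ρ : G → M → M}
    (p : ⋀[ℝ]^k (GroupLieAlgebra 𝓘(ℝ, F) G)) (hf : IsEquivariant ρ (Ad F) f) :
    IsEquivariant (fun g : isotropyComponent p => ρ g) (isotropyAd p)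
      (inducedComponents hkr p f) := by
  intro g i d h hi q
  obtain ⟨j, rfl⟩ : ∃ j, i = j + 1 := ⟨i - 1, by omega⟩
  have hp : exteriorPower.map k (Ad F (g : G)) p = p := isotropyComponent_le p g.2
  have hq : exteriorPower.map (j + 1) (isotropyAlgebra p).toSubmodule.subtype
      (exteriorPower.map (j + 1) (isotropyAd p g) q) = exteriorPower.map (j + 1) (Ad F (g : G))
        (exteriorPower.map (j + 1) (isotropyAlgebra p).toSubmodule.subtype q) := by
    rw [← LinearMap.comp_apply, ← LinearMap.comp_apply, ← exteriorPower.map_comp,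
      ← exteriorPower.map_comp]
    rfl
  have h1 := hf g (j + 1 + k) d (by omega) (by omega) (wedgeRight (j + 1) p
    (exteriorPower.map (j + 1) (isotropyAlgebra p).toSubmodule.subtype q))
  rw [map_wedgeRight, hp, ← hq] at h1
  rw [inducedComponents_succ_apply, inducedComponents_succ_apply, ← h1]
  rfl

end Equivariance

end
end Multisymplectic

/-! ### The proposition. -/

open scoped Manifold ContDiff in
open Multisymplectic in
theorem mainTheorem10
    {E : Type*} [NormedAddCommGroup E] [NormedSpace ℝ E] [FiniteDimensional ℝ E]
    {M : Type*} [TopologicalSpace M] [ChartedSpace E M] [IsManifold 𝓘(ℝ, E) ∞ M]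
    {F : Type*} [NormedAddCommGroup F] [NormedSpace ℝ F] [FiniteDimensional ℝ F] [CompleteSpace F]
    {G : Type*} [TopologicalSpace G] [ChartedSpace F G] [Group G] [LieGroup 𝓘(ℝ, F) ∞ G]
    (ϑ : SmoothRightAction F G E M)
    (n k r : ℕ) (hk : 1 ≤ k) (hkr : k + r = n)
    (η : Form E M (n + 1)) (hη : IsPrePlectic n η)
    (f : Components E M (GroupLieAlgebra 𝓘(ℝ, F) G) n)
    (hf : IsCoMomentumMap ϑ.infinitesimal η f)
    (p : ⋀[ℝ]^k (GroupLieAlgebra 𝓘(ℝ, F) G))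
    (hp : boundary (p : ExteriorAlgebra ℝ (GroupLieAlgebra 𝓘(ℝ, F) G)) = 0)
    (ηp : Form E M (r + 1))
    (hηp : ηp = contract (by omega) (multiField ϑ.infinitesimal p) η) :
    IsPrePlectic r ηp ∧
    (∀ g ∈ isotropyComponent p, pullback (fun m => ϑ.act m g) ηp = ηp) ∧
    IsCoMomentumMap (restrictAction (isotropyAlgebra p) ϑ.infinitesimal) ηp
      (inducedComponents hkr p f) ∧
    (IsEquivariant (fun g m => ϑ.act m g) (Ad F) f →
      IsEquivariant (fun (g : isotropyComponent p) m => ϑ.act m g) (isotropyAd p)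
        (inducedComponents hkr p f)) := by
  have hr : k + (r + 1) = n + 1 := by omega
  -- For closed `η`, Cartan's formula leaves only `d ι_{v_x} η` in the Lie derivative.
  have hx : ∀ x, extD (interior (Nat.add_comm 1 n) (fun m => ϑ.infinitesimal m x) η) = 0 := by
    intro x
    have h := hf.action.lieDerivative_eq_zero x
    rwa [lieDerivative, hη.closed, interior_zero, add_zero] at h
  subst hηp
  exact ⟨hf.morphism.isPrePlectic_contract hk hkr hr p hp,
    fun g hg => pullback_contract_multiField_of_mem_isotropyComponent ϑ hη hx hr p hg,
    isCoMomentumMap_inducedComponents hkr p hp hf hk hr,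
    isEquivariant_inducedComponents hkr p⟩
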